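/- All graphs are finite and simple. For a graph $G$ and an integer $k$, a $k$-coloring of $G$ is a map $c:V(G)\to\{1,\dots,k\}$ with $c(u)\neq c(v)$ for every edge $uv$. A Kempe change of $c$ chooses two distinct colors $i,j$ and a connected component $D$ of the subgraph of $G$ induced by the vertices colored $i$ or $j$, and switches the colors $i$ and $j$ on $D$. Two $k$-colorings are Kempe equivalent if one can be obtained from the other by a finite sequence of Kempe changes, and $\mathrm{Kc}(G,k)$ denotes the number of equivalence classes of $k$-colorings of $G$ under Kempe equivalence. Let $k\ge 4$ and $\ell\ge 0$ be integers with $\ell<\binom{k}{2}$, and let $G$ be a $(k-1)$-colorable graph obtained from a bipartite graph $B$ by adding a set $E$ of $\ell$ edges. Suppose that every connected component of the graph induced by the edges in $E$ is a path, a cycle of length at least $4$, or a complete bipartite graph. Then $\mathrm{Kc}(G,k)=1$. -/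

import Mathlib

namespace Kempe

variable {V : Type*}

/-- The graph `G(i,j)`: the subgraph of `G` induced by the vertices that `c` colours `i` or `j`. -/
abbrev twoColorGraph {G : SimpleGraph V} {k : ℕ} (c : G.Coloring (Fin k)) (i j : Fin k) :
    SimpleGraph {v : V | c v = i ∨ c v = j} :=
  G.induce {v : V | c v = i ∨ c v = j}

open Classical in
/-- `c'` arises from `c` by one Kempe change: for some distinct colours `i`, `j` and some connected
component `D` of `G(i,j)`, the colours `i` and `j` are switched on `D`. -/
def IsKempeChange {G : SimpleGraph V} {k : ℕ} (c c' : G.Coloring (Fin k)) : Prop :=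
  ∃ i j : Fin k, i ≠ j ∧ ∃ D : (twoColorGraph c i j).ConnectedComponent,
    ∀ v : V, c' v = if v ∈ Subtype.val '' D.supp then Equiv.swap i j (c v) else c v

/-- Two `k`-colourings are Kempe equivalent if one is obtained from the other by a (finite,
possibly empty) sequence of Kempe changes. -/
def KempeEquiv {G : SimpleGraph V} {k : ℕ} (c c' : G.Coloring (Fin k)) : Prop :=
  Relation.ReflTransGen IsKempeChange c c'

theorem IsKempeChange.symm {G : SimpleGraph V} {k : ℕ} {c c' : G.Coloring (Fin k)}
    (h : IsKempeChange c c') : IsKempeChange c' c := by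
  classical
  obtain ⟨i, j, hij, D, hD⟩ := h
  have hset : {v : V | c v = i ∨ c v = j} = {v : V | c' v = i ∨ c' v = j} := by
    ext v
    simp only [Set.mem_ofPred_eq, hD v]
    split_ifs with hv
    · rw [Equiv.swap_apply_eq_iff, Equiv.swap_apply_eq_iff, Equiv.swap_apply_left,
        Equiv.swap_apply_right, or_comm]
    · rfl
  have key : ∀ t : Set V, {v : V | c v = i ∨ c v = j} = t →
      ∃ D' : (G.induce t).ConnectedComponent,
        Subtype.val '' D'.supp = Subtype.val '' D.supp := by
    rintro t rfl
    exact ⟨D, rfl⟩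
  obtain ⟨D', hD'⟩ := key _ hset
  refine ⟨i, j, hij, D', fun v => ?_⟩
  rw [hD', hD v]
  split_ifs with hv
  · rw [Equiv.swap_apply_self]
  · rfl

theorem kempeEquiv_equivalence (G : SimpleGraph V) (k : ℕ) :
    Equivalence (KempeEquiv (G := G) (k := k)) where
  refl _ := Relation.ReflTransGen.refl
  symm h := by
    induction h with
    | refl => exact Relation.ReflTransGen.refl
    | tail _ hbc ih => exact Relation.ReflTransGen.head hbc.symm ih
  trans h₁ h₂ := Relation.ReflTransGen.trans h₁ h₂

/-- Kempe equivalence on the set of all `k`-colourings of `G`. -/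
def kempeSetoid (G : SimpleGraph V) (k : ℕ) : Setoid (G.Coloring (Fin k)) :=
  ⟨KempeEquiv, kempeEquiv_equivalence G k⟩

/-- `Kc(G,k)`: the number of Kempe equivalence classes of `k`-colourings of `G`. -/
noncomputable def Kc (G : SimpleGraph V) (k : ℕ) : ℕ :=
  Nat.card (Quotient (kempeSetoid G k))

/-- `G` is a `B + E_ℓ` graph with based bipartite graph `B` and added edges `E`: `B` is bipartite
and `G` is obtained from `B` by adding the `ℓ` edges of `E`, none of which is an edge of `B`. -/
structure IsBipartiteAdd (G B E : SimpleGraph V) (ℓ : ℕ) : Prop where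
  bipartite : B.IsBipartite
  disjoint : Disjoint B E
  eq_sup : G = B ⊔ E
  card_edges : E.edgeSet.ncard = ℓ

/-- `H` is a path (on any number of vertices). -/
def IsPathGraph (H : SimpleGraph V) : Prop :=
  ∃ n : ℕ, Nonempty (H ≃g SimpleGraph.pathGraph n)

/-- `H` is a cycle of length at least `4`. -/
def IsLongCycleGraph (H : SimpleGraph V) : Prop :=
  ∃ n : ℕ, 4 ≤ n ∧ Nonempty (H ≃g SimpleGraph.cycleGraph n)

/-- `H` is a complete bipartite graph with nonempty partite sets. -/
def IsCompleteBipartiteGraph (H : SimpleGraph V) : Prop :=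
  ∃ m n : ℕ, 1 ≤ m ∧ 1 ≤ n ∧ Nonempty (H ≃g completeBipartiteGraph (Fin m) (Fin n))

end Kempe

/-! Let `s` be the bipartition of `B`. The edges of `G` inside a side all come from `E`, so the
graph `H` they form has fewer than `k.choose 2` edges and is `Sparse`: triangle-free, with pairwise
twin neighbours at any vertex of degree at least 3. Hence every nonempty vertex set contains a
vertex having at most two neighbours in the set, or a twin in it. Removing such vertices one by one
shows that colourings of a part of one side from a palette reserved for that part are all equivalent
(`Sparse.reach`). It follows that any two pure colourings, in which every colour keeps to one side,
are equivalent (`reach_of_pure`). It remains to purify an arbitrary colouring.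

Label some colours known to be one-sided, and minimise the number of unlabelled colours, then the
number of vertices carrying them. If an unlabelled colour survives, every two colours are joined by
an edge of `H`, unless they have opposite labels. With `p` and `q` labels for the two sides, fewer
than `p * q` edges are left over (`card_lt_mul`). Three labels on a side would suffice to colour one
more vertex there, and a side with exactly two labels wastes at least two edges; so `p = q = 1` and
no edge is wasted.

If `k ≥ 5`, three unlabelled colours are pairwise joined by edges of `H`, two of which lie on one
side; the twin condition forbids this (`side_ne`). If `k = 4`, the colouring is a rigid
`TightConfig`. Each adjacency absent from it opens a way to purify all colours but one. When all are
present, a 3-colouring of `G` shows certain vertices to be nonadjacent, which again permits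
purification. -/

namespace Kempe

/-! ### Kempe changes and two-colour changes -/

section Recolouring

variable {V : Type*} {G : SimpleGraph V} {k : ℕ}

/-- `f` is a proper colouring of `G`. -/
def Proper (G : SimpleGraph V) (f : V → Fin k) : Prop :=
  ∀ ⦃u v⦄, G.Adj u v → f u ≠ f v

/-- `f` and `g` agree up to an exchange of the colours `i` and `j` at some vertices. -/
def AgreeOff (i j : Fin k) (f g : V → Fin k) : Prop :=
  ∀ v, f v = g v ∨ ((f v = i ∨ f v = j) ∧ (g v = i ∨ g v = j))

/-- On each component of the `i`, `j`-subgraph the two colourings agree everywhere or differ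
everywhere. Switching a component of the second kind removes its disagreements and creates none. -/
theorem kempeEquiv_of_agreeOff [Finite V] {i j : Fin k} (c c' : G.Coloring (Fin k))
    (h : AgreeOff i j c c') : KempeEquiv c c' := by
  classical
  induction hn : {v | c v ≠ c' v}.ncard using Nat.strong_induction_on generalizing c with
  | _ n ih =>
  by_cases hall : ∀ v, c v = c' v
  · have : c = c' := DFunLike.ext _ _ hall
    rw [this]
    exact Relation.ReflTransGen.refl
  push Not at hall
  obtain ⟨v₀, hv₀⟩ := hall
  have hm : ∀ v, c v ≠ c' v → c v = i ∨ c v = j := fun v hv => ((h v).resolve_left hv).1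
  have hij : i ≠ j := by
    rintro rfl
    rcases h v₀ with h' | ⟨h1, h2⟩
    · exact hv₀ h'
    · simp only [or_self] at h1 h2
      exact hv₀ (h1.trans h2.symm)
  have hstep : ∀ u v, G.Adj u v → (c u = i ∨ c u = j) → (c v = i ∨ c v = j) →
      c u ≠ c' u → c v ≠ c' v := by
    intro u v huv hu hv hne
    have h1 := c.valid huv
    have h2 := c'.valid huv
    have h3 := h u
    have h4 := h v
    grind
  let w₀ : {v : V | c v = i ∨ c v = j} := ⟨v₀, hm v₀ hv₀⟩
  have hdiff : ∀ w : {v : V | c v = i ∨ c v = j}, (twoColorGraph c i j).Reachable w₀ w →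
      c w ≠ c' w := by
    intro w hw
    rw [SimpleGraph.reachable_iff_reflTransGen] at hw
    induction hw with
    | refl => exact hv₀
    | @tail a b _ hab ih' => exact hstep a b hab a.2 b.2 ih'
  let D := (twoColorGraph c i j).connectedComponentMk w₀
  let T : Set V := Subtype.val '' D.supp
  have hT : ∀ v, v ∈ T ↔ ∃ hv : c v = i ∨ c v = j, (twoColorGraph c i j).Reachable w₀ ⟨v, hv⟩ := by
    intro v
    constructor
    · rintro ⟨w, hw, rfl⟩
      exact ⟨w.2, (SimpleGraph.ConnectedComponent.exact hw).symm⟩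
    · rintro ⟨hv, hr⟩
      exact ⟨⟨v, hv⟩, SimpleGraph.ConnectedComponent.sound hr.symm, rfl⟩
  have hTd : ∀ v ∈ T, (c v = i ∨ c v = j) ∧ c v ≠ c' v := by
    intro v hv
    obtain ⟨h1, h2⟩ := (hT v).1 hv
    exact ⟨h1, hdiff _ h2⟩
  have hclosed : ∀ u v, G.Adj u v → u ∈ T → (c v = i ∨ c v = j) → v ∈ T := by
    intro u v huv hu hv
    obtain ⟨h1, h2⟩ := (hT u).1 hu
    refine (hT v).2 ⟨hv, h2.trans (SimpleGraph.Adj.reachable ?_)⟩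
    exact huv
  let g : V → Fin k := fun v => if v ∈ T then Equiv.swap i j (c v) else c v
  have hgT : ∀ v ∈ T, g v = c' v := by
    intro v hv
    obtain ⟨h1, h2⟩ := hTd v hv
    have h3 := h v
    simp only [g, if_pos hv]
    rcases h1 with h1 | h1
    · rw [h1, Equiv.swap_apply_left]; grind
    · rw [h1, Equiv.swap_apply_right]; grind
  have hgN : ∀ v, v ∉ T → g v = c v := fun v hv => if_neg hv
  have hgv : ∀ {u v}, G.Adj u v → g u ≠ g v := by
    intro u v huv
    have h1 := c.valid huv
    have h2 := c'.valid huv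
    by_cases hu : u ∈ T <;> by_cases hv : v ∈ T
    · rw [hgT u hu, hgT v hv]; exact h2
    · rw [hgT u hu, hgN v hv]
      have := mt (hclosed u v huv hu) hv
      have := hTd u hu
      have := h u
      grind
    · rw [hgN u hu, hgT v hv]
      have := mt (hclosed v u huv.symm hv) hu
      have := hTd v hv
      have := h v
      grind
    · rw [hgN u hu, hgN v hv]; exact h1
  let c'' : G.Coloring (Fin k) := SimpleGraph.Coloring.mk g hgv
  have h1 : IsKempeChange c c'' := ⟨i, j, hij, D, fun v => rfl⟩
  refine Relation.ReflTransGen.head h1 (ih _ ?_ c'' ?_ rfl)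
  · rw [← hn]
    refine Set.ncard_lt_ncard ⟨?_, ?_⟩ (Set.toFinite _)
    · intro v hv
      by_cases hvT : v ∈ T
      · exact absurd (hgT v hvT) hv
      · have : g v ≠ c' v := hv
        rw [hgN v hvT] at this
        exact this
    · intro hsub
      have : v₀ ∈ T := (hT v₀).2 ⟨hm v₀ hv₀, SimpleGraph.Reachable.refl _⟩
      exact hsub hv₀ (hgT v₀ this)
  · intro v
    by_cases hvT : v ∈ T
    · exact Or.inl (hgT v hvT)
    · have : c'' v = c v := hgN v hvT
      rw [this]
      exact h v

/-- The equivalence relation on proper colourings generated by changes that involve only two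
colours. -/
def Reach (G : SimpleGraph V) : (V → Fin k) → (V → Fin k) → Prop :=
  Relation.ReflTransGen fun f g => Proper G f ∧ Proper G g ∧ ∃ i j, AgreeOff i j f g

theorem Reach.refl (f : V → Fin k) : Reach G f f := Relation.ReflTransGen.refl

theorem Reach.trans {f g h : V → Fin k} (h₁ : Reach G f g) (h₂ : Reach G g h) : Reach G f h :=
  Relation.ReflTransGen.trans h₁ h₂

theorem Reach.single {f g : V → Fin k} (hf : Proper G f) (hg : Proper G g) {i j : Fin k}
    (h : AgreeOff i j f g) : Reach G f g :=
  Relation.ReflTransGen.single ⟨hf, hg, i, j, h⟩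

theorem Reach.symm {f g : V → Fin k} (h : Reach G f g) : Reach G g f := by
  induction h with
  | refl => exact Reach.refl _
  | tail _ hbc ih =>
    obtain ⟨h1, h2, i, j, h3⟩ := hbc
    exact Reach.trans (Reach.single h2 h1 (i := i) (j := j)
      fun v => (h3 v).imp Eq.symm And.symm) ih

theorem Reach.proper {f g : V → Fin k} (h : Reach G f g) (hf : Proper G f) : Proper G g := by
  induction h with
  | refl => exact hf
  | tail _ hbc _ => exact hbc.2.1

theorem Reach.kempeEquiv [Finite V] (c c' : G.Coloring (Fin k)) (h : Reach G c c') :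
    KempeEquiv c c' := by
  suffices ∀ g : V → Fin k, Reach G c g → ∀ c'' : G.Coloring (Fin k), ⇑c'' = g →
      KempeEquiv c c'' from this _ h _ rfl
  intro g hg
  induction hg with
  | refl =>
    intro c'' hc
    rw [DFunLike.coe_injective hc]
    exact Relation.ReflTransGen.refl
  | @tail a b _ hbc ih =>
    obtain ⟨h1, h2, i, j, h3⟩ := hbc
    intro c'' hc
    let d : G.Coloring (Fin k) := SimpleGraph.Coloring.mk a fun h => h1 h
    refine Relation.ReflTransGen.trans (ih d rfl)
      (kempeEquiv_of_agreeOff (i := i) (j := j) d c'' ?_)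
    rw [hc]
    exact h3

theorem Proper.perm {f : V → Fin k} (hf : Proper G f) (σ : Equiv.Perm (Fin k)) :
    Proper G (σ ∘ f) := fun _ _ huv h => hf huv (σ.injective h)

theorem Proper.reach_perm {f : V → Fin k} (hf : Proper G f) (σ : Equiv.Perm (Fin k)) :
    Reach G f (σ ∘ f) := by
  induction σ using Equiv.Perm.swap_induction_on with
  | one => exact Reach.refl _
  | swap_mul σ i j _ ih =>
    refine ih.trans (Reach.single (hf.perm σ) (hf.perm _) (i := i) (j := j) fun v => ?_)
    simp only [Function.comp_apply, Equiv.Perm.coe_mul, Equiv.swap_apply_def]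
    grind

open Classical in
/-- Redistribution of the vertices coloured `i` or `j`: those in `D` get `i`, the others `j`. -/
noncomputable def resplit (f : V → Fin k) (i j : Fin k) (D : V → Prop) : V → Fin k := fun v =>
  if f v = i ∨ f v = j then (if D v then i else j) else f v

theorem Proper.resplit {f : V → Fin k} (hf : Proper G f) (i j : Fin k) (D : V → Prop)
    (h : ∀ u v, G.Adj u v → f u = i → f v = j → (D u ↔ ¬ D v)) :
    Proper G (resplit f i j D) := by
  intro u v huv
  have h1 := hf huv
  have h2 := h u v huv
  have h3 := h v u huv.symm
  unfold Kempe.resplit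
  grind

theorem Proper.reach_resplit {f : V → Fin k} (hf : Proper G f) (i j : Fin k) (D : V → Prop)
    (h : ∀ u v, G.Adj u v → f u = i → f v = j → (D u ↔ ¬ D v)) :
    Reach G f (Kempe.resplit f i j D) := by
  refine Reach.single hf (hf.resplit i j D h) (i := i) (j := j) fun v => ?_
  unfold Kempe.resplit
  grind

theorem reach_update [DecidableEq V] {f : V → Fin k} (hf : Proper G f) (u : V) (j : Fin k)
    (h : ∀ v, G.Adj u v → f v ≠ j) :
    Proper G (Function.update f u j) ∧ Reach G f (Function.update f u j) := by
  have hp : Proper G (Function.update f u j) := by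
    intro a b hab
    have h1 := hf hab
    have h2 := hab.ne
    by_cases ha : a = u
    · subst ha
      simpa [Function.update_of_ne h2.symm] using (h b hab).symm
    · by_cases hb : b = u
      · subst hb
        simpa [Function.update_of_ne h2] using h a hab.symm
      · simpa [Function.update_of_ne ha, Function.update_of_ne hb] using h1
  refine ⟨hp, Reach.single hf hp (i := f u) (j := j) fun v => ?_⟩
  by_cases hv : v = u
  · subst hv; simp
  · simp [Function.update_of_ne hv]

end Recolouring

/-! ### Recolouring sparse graphs -/

section TwinGraphs

variable {V : Type*} {H : SimpleGraph V} {k : ℕ}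

/-- `H` is triangle-free, and the neighbours of any vertex of degree at least `3` are twins:
a local form of "every component has maximum degree `2` or is complete bipartite". -/
structure Sparse (H : SimpleGraph V) : Prop where
  triangleFree : ∀ ⦃a b c⦄, H.Adj a b → H.Adj b c → ¬ H.Adj a c
  twins : ∀ ⦃u a b d⦄, H.Adj u a → H.Adj u b → H.Adj u d → a ≠ b → a ≠ d → b ≠ d →
    ∀ w, H.Adj a w → H.Adj b w

/-- Among three neighbours of a vertex any two are twins; a vertex without three neighbours in `S`
serves itself. -/
theorem Sparse.exists_removable (hH : Sparse H) {S : Finset V} (hS : S.Nonempty) :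
    ∃ v ∈ S, (∃ w w', ∀ z ∈ S, H.Adj v z → z = w ∨ z = w') ∨
      ∃ t ∈ S, t ≠ v ∧ ∀ z, H.Adj v z ↔ H.Adj t z := by
  classical
  obtain ⟨u, hu⟩ := hS
  by_cases h : 2 < (S.filter (H.Adj u)).card
  · obtain ⟨a, b, d, ha, hb, hd, hab, had, hbd⟩ := Finset.two_lt_card_iff.1 h
    rw [Finset.mem_filter] at ha hb hd
    exact ⟨a, ha.1, Or.inr ⟨b, hb.1, hab.symm, fun z =>
      ⟨hH.twins ha.2 hb.2 hd.2 hab had hbd z, hH.twins hb.2 ha.2 hd.2 hab.symm hbd had z⟩⟩⟩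
  · refine ⟨u, hu, Or.inl ?_⟩
    rw [not_lt] at h
    obtain h0 | h0 := (S.filter (H.Adj u)).eq_empty_or_nonempty
    · refine ⟨u, u, fun z hz hz' => ?_⟩
      have : z ∈ S.filter (H.Adj u) := Finset.mem_filter.2 ⟨hz, hz'⟩
      simp [h0] at this
    · obtain ⟨w, hw⟩ := h0
      by_cases h1 : ∃ w' ∈ S.filter (H.Adj u), w' ≠ w
      · obtain ⟨w', hw', hne⟩ := h1
        refine ⟨w, w', fun z hz hz' => ?_⟩
        by_contra hcon
        push Not at hcon
        exact absurd (Finset.two_lt_card_iff.2 ⟨w, w', z, hw, hw',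
          Finset.mem_filter.2 ⟨hz, hz'⟩, hne.symm, hcon.1.symm, hcon.2.symm⟩) (not_lt.2 h)
      · push Not at h1
        exact ⟨w, w, fun z hz hz' => Or.inl (h1 z (Finset.mem_filter.2 ⟨hz, hz'⟩))⟩

/-- `f` restricts to a proper colouring of `H[S]` from the palette `P`. -/
def ProperOn (H : SimpleGraph V) (S : Finset V) (P : Finset (Fin k)) (f : V → Fin k) : Prop :=
  (∀ u ∈ S, f u ∈ P) ∧ ∀ u ∈ S, ∀ v ∈ S, H.Adj u v → f u ≠ f v

theorem ProperOn.mono {S T : Finset V} {P : Finset (Fin k)} {f : V → Fin k}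
    (h : ProperOn H S P f) (hT : T ⊆ S) : ProperOn H T P f :=
  ⟨fun u hu => h.1 u (hT hu), fun u hu v hv => h.2 u (hT hu) v (hT hv)⟩

theorem ProperOn.update [DecidableEq V] {S : Finset V} {P : Finset (Fin k)} {f : V → Fin k} {v : V}
    (h : ProperOn H (S.erase v) P f) {a : Fin k} (ha : a ∈ P)
    (hn : ∀ z ∈ S, H.Adj v z → f z ≠ a) : ProperOn H S P (Function.update f v a) := by
  refine ⟨fun u hu => ?_, fun x hx y hy hxy => ?_⟩
  · by_cases huv : u = v
    · subst huv; simpa using ha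
    · rw [Function.update_of_ne huv]; exact h.1 u (Finset.mem_erase.2 ⟨huv, hu⟩)
  · have hne := hxy.ne
    by_cases hxv : x = v
    · subst hxv
      simpa [Function.update_of_ne hne.symm] using (hn y hy hxy).symm
    · by_cases hyv : y = v
      · subst hyv
        simpa [Function.update_of_ne hne] using hn x hx hxy.symm
      · rw [Function.update_of_ne hxv, Function.update_of_ne hyv]
        exact h.2 x (Finset.mem_erase.2 ⟨hxv, hx⟩) y (Finset.mem_erase.2 ⟨hyv, hy⟩) hxy

theorem Sparse.exists_properOn (hH : Sparse H) {P : Finset (Fin k)} (hP : 3 ≤ P.card)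
    (S : Finset V) : ∃ f : V → Fin k, ProperOn H S P f := by
  classical
  have hP0 : P.Nonempty := Finset.card_pos.1 (by omega)
  induction hn : S.card generalizing S with
  | zero =>
    rw [Finset.card_eq_zero] at hn
    subst hn
    exact ⟨fun _ => hP0.choose, by simp [ProperOn]⟩
  | succ n ih =>
    have hS : S.Nonempty := Finset.card_pos.1 (by omega)
    obtain ⟨v, hv, h⟩ := hH.exists_removable hS
    obtain ⟨f, hf⟩ := ih (S.erase v) (by rw [Finset.card_erase_of_mem hv, hn]; rfl)
    rcases h with ⟨w, w', h⟩ | ⟨t, ht, htv, h⟩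
    · obtain ⟨a, ha, ha'⟩ := Finset.exists_mem_notMem_of_card_lt_card
        (s := {f w, f w'}) (t := P) (lt_of_le_of_lt Finset.card_le_two (by omega))
      refine ⟨Function.update f v a, hf.update ha fun z hz hvz => ?_⟩
      rcases h z hz hvz with rfl | rfl <;> rintro rfl <;> simp at ha'
    · have ht' : t ∈ S.erase v := Finset.mem_erase.2 ⟨htv, ht⟩
      exact ⟨Function.update f v (f t), hf.update (hf.1 t ht') fun z hz hvz =>
        (hf.2 t ht' z (Finset.mem_erase.2 ⟨hvz.ne', hz⟩) ((h z).1 hvz)).symm⟩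

/-- A two-colour change between proper colourings of `H[S]` from the palette `P`. -/
def StepOn (H : SimpleGraph V) (S : Finset V) (P : Finset (Fin k)) (f g : V → Fin k) : Prop :=
  ProperOn H S P f ∧ ProperOn H S P g ∧ (∀ v ∉ S, f v = g v) ∧ ∃ i j, AgreeOff i j f g

theorem stepOn_update [DecidableEq V] {S : Finset V} {P : Finset (Fin k)} {f : V → Fin k} {v : V}
    (hv : v ∈ S) (hf : ProperOn H S P f) {a : Fin k} (ha : a ∈ P)
    (hn : ∀ z ∈ S, H.Adj v z → f z ≠ a) : StepOn H S P f (Function.update f v a) := by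
  refine ⟨hf, (hf.mono (Finset.erase_subset v S)).update ha hn, fun z hz => ?_, f v, a,
    fun z => ?_⟩
  · rw [Function.update_of_ne]; rintro rfl; exact hz hv
  · by_cases hz : z = v
    · subst hz; simp
    · simp [Function.update_of_ne hz]

theorem stepOn_update_update [DecidableEq V] {S : Finset V} {P : Finset (Fin k)}
    {f g : V → Fin k} {v : V} {i j : Fin k}
    (hfg : ∀ z ∉ S.erase v, f z = g z) (hij : AgreeOff i j f g) {a b : Fin k}
    (hf : ProperOn H S P (Function.update f v a)) (hg : ProperOn H S P (Function.update g v b))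
    (hv : v ∈ S)
    (hab : a = b ∨ ((a = i ∨ a = j) ∧ (b = i ∨ b = j))) :
    StepOn H S P (Function.update f v a) (Function.update g v b) := by
  refine ⟨hf, hg, fun z hz => ?_, i, j, fun z => ?_⟩
  · have : z ≠ v := by rintro rfl; exact hz hv
    rw [Function.update_of_ne this, Function.update_of_ne this]
    exact hfg z fun h => hz (Finset.mem_of_mem_erase h)
  · by_cases hz : z = v
    · subst hz; simpa using hab
    · simpa [Function.update_of_ne hz] using hij z

/-- Keep `a` at `v` if `g` allows it; otherwise let `v` join the exchange of `i` and `j`. If both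
fail, the neighbours of `v` in `S` use only `i` and `j` before and after the step, so `v` can first
escape to a third colour of `P`. -/
theorem StepOn.lift_of_two_neighbours [DecidableEq V] {S : Finset V} {P : Finset (Fin k)}
    (hP : 3 ≤ P.card) {f g : V → Fin k} {v w w' : V} (hv : v ∈ S)
    (hw : ∀ z ∈ S, H.Adj v z → z = w ∨ z = w') (hfg : StepOn H (S.erase v) P f g)
    {a : Fin k} (hf : ProperOn H S P (Function.update f v a)) :
    ∃ b, Relation.ReflTransGen (StepOn H S P) (Function.update f v a) (Function.update g v b) ∧
      ProperOn H S P (Function.update g v b) := by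
  obtain ⟨hf', hg', hoff, i, j, hij⟩ := hfg
  have haP : a ∈ P := by simpa using hf.1 v hv
  have key : ∀ b ∈ P, (∀ z ∈ S, H.Adj v z → g z ≠ b) →
      (a = b ∨ ((a = i ∨ a = j) ∧ (b = i ∨ b = j))) →
      ∃ b, Relation.ReflTransGen (StepOn H S P) (Function.update f v a) (Function.update g v b) ∧
      ProperOn H S P (Function.update g v b) := by
    intro b hb hn hab
    have hg := hg'.update hb hn
    exact ⟨b, Relation.ReflTransGen.single (stepOn_update_update hoff hij hf hg hv hab), hg⟩
  by_cases h1 : ∀ z ∈ S, H.Adj v z → g z ≠ a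
  · exact key a haP h1 (Or.inl rfl)
  push Not at h1
  obtain ⟨z₁, hz₁, hvz₁, hgz₁⟩ := h1
  have hz₁f : f z₁ ≠ a := by
    have := hf.2 v hv z₁ hz₁ hvz₁
    rw [Function.update_self, Function.update_of_ne hvz₁.ne'] at this
    exact this.symm
  have hz₁P : f z₁ ∈ P := hf'.1 z₁ (Finset.mem_erase.2 ⟨hvz₁.ne', hz₁⟩)
  have hz₁ij := hij z₁
  by_cases h2 : ∀ z ∈ S, H.Adj v z → g z ≠ f z₁
  · exact key (f z₁) hz₁P h2 (by grind)
  push Not at h2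
  obtain ⟨z₂, hz₂, hvz₂, hgz₂⟩ := h2
  have hz₂ij := hij z₂
  obtain ⟨b, hb, hb'⟩ := Finset.exists_mem_notMem_of_card_lt_card
    (s := {i, j}) (t := P) (lt_of_le_of_lt Finset.card_le_two (by omega))
  have hbij : b ≠ i ∧ b ≠ j := by simpa using hb'
  have hcol : ∀ z ∈ S, H.Adj v z → f z ≠ b ∧ g z ≠ b := by
    intro z hz hvz
    have := hw z hz hvz
    have := hw z₁ hz₁ hvz₁
    have := hw z₂ hz₂ hvz₂
    have : z = z₁ ∨ z = z₂ := by grind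
    grind
  have s1 : StepOn H S P (Function.update f v a) (Function.update f v b) := by
    have := stepOn_update hv hf hb (fun z hz hvz => by
      rw [Function.update_of_ne hvz.ne']; exact (hcol z hz hvz).1)
    simpa using this
  have hg := hg'.update hb fun z hz hvz => (hcol z hz hvz).2
  exact ⟨b, (Relation.ReflTransGen.single s1).tail
    (stepOn_update_update hoff hij s1.2.1 hg hv (Or.inl rfl)), hg⟩

/-- First give `v` the colour of its twin `t`; then `v` copies `t` during the step. -/
theorem StepOn.lift_of_twin [DecidableEq V] {S : Finset V} {P : Finset (Fin k)}
    {f g : V → Fin k} {v t : V} (hv : v ∈ S) (ht : t ∈ S) (htv : t ≠ v)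
    (htw : ∀ z, H.Adj v z ↔ H.Adj t z) (hfg : StepOn H (S.erase v) P f g)
    {a : Fin k} (hf : ProperOn H S P (Function.update f v a)) :
    ∃ b, Relation.ReflTransGen (StepOn H S P) (Function.update f v a) (Function.update g v b) ∧
      ProperOn H S P (Function.update g v b) := by
  obtain ⟨hf', hg', hoff, i, j, hij⟩ := hfg
  have ht' : t ∈ S.erase v := Finset.mem_erase.2 ⟨htv, ht⟩
  have key : ∀ h, ProperOn H (S.erase v) P h → ∀ z ∈ S, H.Adj v z → h z ≠ h t :=
    fun h hh z hz hvz =>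
      (hh.2 t ht' z (Finset.mem_erase.2 ⟨hvz.ne', hz⟩) ((htw z).1 hvz)).symm
  have s1 : StepOn H S P (Function.update f v a) (Function.update f v (f t)) := by
    have := stepOn_update hv hf (hf'.1 t ht') (fun z hz hvz => by
      rw [Function.update_of_ne hvz.ne']; exact key f hf' z hz hvz)
    simpa using this
  have hg := hg'.update (hg'.1 t ht') (key g hg')
  exact ⟨g t, (Relation.ReflTransGen.single s1).tail
    (stepOn_update_update hoff hij s1.2.1 hg hv (hij t)), hg⟩

theorem Sparse.reflTransGen_stepOn (hH : Sparse H) {P : Finset (Fin k)} (hP : 3 ≤ P.card)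
    (S : Finset V) {f g : V → Fin k} (hf : ProperOn H S P f) (hg : ProperOn H S P g)
    (hfg : ∀ v ∉ S, f v = g v) : Relation.ReflTransGen (StepOn H S P) f g := by
  classical
  induction hn : S.card generalizing S f g with
  | zero =>
    rw [Finset.card_eq_zero] at hn
    subst hn
    have : f = g := funext fun v => hfg v (Finset.notMem_empty v)
    rw [this]
  | succ n ih =>
    have hS : S.Nonempty := Finset.card_pos.1 (by omega)
    obtain ⟨v, hv, h⟩ := hH.exists_removable hS
    have hlift : ∀ f g : V → Fin k, StepOn H (S.erase v) P f g → ∀ a,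
        ProperOn H S P (Function.update f v a) → ∃ b, Relation.ReflTransGen (StepOn H S P)
          (Function.update f v a) (Function.update g v b) ∧
          ProperOn H S P (Function.update g v b) := by
      intro f g hfg a ha
      rcases h with ⟨w, w', h⟩ | ⟨t, ht, htv, h⟩
      · exact hfg.lift_of_two_neighbours hP hv h ha
      · exact hfg.lift_of_twin hv ht htv h ha
    -- Steps on `S.erase v` leave `v` alone, so the intermediate target keeps the colour `f v`; a
    -- last recolouring of `v` corrects it.
    have hg₁ : ProperOn H (S.erase v) P (Function.update g v (f v)) := by
      have := hg.mono (Finset.erase_subset v S)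
      refine ⟨fun u hu => ?_, fun x hx y hy hxy => ?_⟩
      · rw [Function.update_of_ne (Finset.ne_of_mem_erase hu)]; exact this.1 u hu
      · rw [Function.update_of_ne (Finset.ne_of_mem_erase hx),
          Function.update_of_ne (Finset.ne_of_mem_erase hy)]
        exact this.2 x hx y hy hxy
    have hpath := ih (S.erase v) (f := f) (g := Function.update g v (f v))
      (hf.mono (Finset.erase_subset v S)) hg₁ (fun z hz => by
        by_cases hzv : z = v
        · subst hzv; simp
        · rw [Function.update_of_ne hzv]
          exact hfg z fun h => hz (Finset.mem_erase.2 ⟨hzv, h⟩))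
      (by rw [Finset.card_erase_of_mem hv, hn]; rfl)
    have : ∀ g', Relation.ReflTransGen (StepOn H (S.erase v) P) f g' → ∃ b,
        Relation.ReflTransGen (StepOn H S P) f (Function.update g' v b) ∧
          ProperOn H S P (Function.update g' v b) := by
      intro g' hg'
      induction hg' with
      | refl => exact ⟨f v, by rw [Function.update_eq_self], by rwa [Function.update_eq_self]⟩
      | tail _ hbc ih' =>
        obtain ⟨b, hb, hb'⟩ := ih'
        obtain ⟨b', h1, h2⟩ := hlift _ _ hbc b hb'
        exact ⟨b', hb.trans h1, h2⟩
    obtain ⟨b, hb, hb'⟩ := this _ hpath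
    rw [Function.update_idem] at hb hb'
    refine hb.tail ?_
    have := stepOn_update hv hb' (hg.1 v hv) (fun z hz hvz => by
      rw [Function.update_of_ne hvz.ne']; exact (hg.2 v hv z hz hvz).symm)
    simpa using this

/-- Covers the palettes too small for the induction: all recolouring from two colours is a single
two-colour change. -/
theorem ProperOn.agreeOff {P : Finset (Fin k)} (hP : P.card ≤ 2)
    {S : Finset V} {f g : V → Fin k} (hf : ProperOn H S P f) (hg : ProperOn H S P g)
    (hfg : ∀ v ∉ S, f v = g v) : f = g ∨ ∃ i j, AgreeOff i j f g := by
  obtain h0 | ⟨i, hi⟩ := P.eq_empty_or_nonempty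
  · refine Or.inl (funext fun v => hfg v fun hv => ?_)
    simpa [h0] using hf.1 v hv
  · have : ∃ j, ∀ m ∈ P, m = i ∨ m = j := by
      by_cases h1 : ∃ j ∈ P, j ≠ i
      · obtain ⟨j, hj, hne⟩ := h1
        refine ⟨j, fun m hm => ?_⟩
        by_contra hcon
        push Not at hcon
        exact absurd (Finset.two_lt_card_iff.2 ⟨i, j, m, hi, hj, hm, hne.symm, hcon.1.symm,
          hcon.2.symm⟩) (not_lt.2 hP)
      · push Not at h1
        exact ⟨i, fun m hm => Or.inl (h1 m hm)⟩
    obtain ⟨j, hj⟩ := this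
    refine Or.inr ⟨i, j, fun v => ?_⟩
    by_cases hv : v ∈ S
    · exact Or.inr ⟨hj _ (hf.1 v hv), hj _ (hg.1 v hv)⟩
    · exact Or.inl (hfg v hv)

/-- If the vertices of `S` use colours of `P`, the other vertices do not, and `G` induces on `S` a
subgraph of a sparse graph, then the colouring on `S` may be changed at will. -/
theorem Sparse.reach {G : SimpleGraph V} (hH : Sparse H) {S : Finset V}
    (hGH : ∀ u ∈ S, ∀ v ∈ S, G.Adj u v ↔ H.Adj u v) {P : Finset (Fin k)} {f g : V → Fin k}
    (hf : Proper G f) (hfS : ∀ v, v ∈ S ↔ f v ∈ P) (hg : ProperOn H S P g)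
    (hfg : ∀ v ∉ S, f v = g v) : Reach G f g := by
  have hfP : ProperOn H S P f :=
    ⟨fun u hu => (hfS u).1 hu, fun u hu v hv huv => hf ((hGH u hu v hv).2 huv)⟩
  have hprop : ∀ h, ProperOn H S P h → (∀ v ∉ S, f v = h v) → Proper G h := by
    intro h hh hoff u v huv
    by_cases hu : u ∈ S <;> by_cases hv : v ∈ S
    · exact hh.2 u hu v hv ((hGH u hu v hv).1 huv)
    · have h1 := hh.1 u hu
      have h2 := mt (hfS v).2 hv
      rw [hoff v hv] at h2
      exact fun h => h2 (h ▸ h1)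
    · have h1 := hh.1 v hv
      have h2 := mt (hfS u).2 hu
      rw [hoff u hu] at h2
      exact fun h => h2 (h ▸ h1)
    · rw [← hoff u hu, ← hoff v hv]
      exact hf huv
  rcases le_or_gt P.card 2 with hP | hP
  · rcases hfP.agreeOff hP hg hfg with rfl | ⟨i, j, h⟩
    · exact Reach.refl _
    · exact Reach.single hf (hprop g hg hfg) h
  · have := hH.reflTransGen_stepOn hP S hfP hg hfg
    suffices ∀ h, Relation.ReflTransGen (StepOn H S P) f h →
        Reach G f h ∧ ∀ v ∉ S, f v = h v from (this g ‹_›).1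
    intro h hh
    induction hh with
    | refl => exact ⟨Reach.refl _, fun _ _ => rfl⟩
    | tail _ hbc ih =>
      obtain ⟨h1, h2, h3, i, j, h4⟩ := hbc
      have h5 : ∀ v ∉ S, f v = _ := fun v hv => (ih.2 v hv).trans (h3 v hv)
      exact ⟨ih.1.trans (Reach.single (hprop _ h1 ih.2) (hprop _ h2 h5) h4), h5⟩

end TwinGraphs

/-! ### Pure colourings, and adding a vertex to two colours of a side -/

section Sides

variable {V : Type*} {G : SimpleGraph V} {k : ℕ}

/-- The edges of `G` whose ends lie on the same side of the partition `s`. -/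
def sameSide (G : SimpleGraph V) (s : V → Bool) : SimpleGraph V where
  Adj u v := G.Adj u v ∧ s u = s v
  symm := ⟨fun _ _ h => ⟨h.1.symm, h.2.symm⟩⟩
  loopless := ⟨fun _ h => h.1.ne rfl⟩

theorem exists_perm_of_card_le {α : Type*} [Fintype α] [DecidableEq α] {A B : Finset α}
    (h : A.card ≤ B.card) : ∃ σ : Equiv.Perm α, ∀ i ∈ A, σ i ∈ B := by
  obtain ⟨C, hCB, hC⟩ := Finset.exists_subset_card_eq h
  let e : {x // x ∈ A} ≃ {x // x ∈ C} := Finset.equivOfCardEq hC.symm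
  exact ⟨e.extendSubtype, fun i hi => hCB (e.extendSubtype_mem i hi)⟩

/-- Any two colourings in which every colour class lies on one side are equivalent. -/
theorem reach_of_pure [Fintype V] {s : V → Bool} (hH : Sparse (sameSide G s))
    {f g : V → Fin k} (hf : Proper G f) (hg : Proper G g) {τ τ' : Fin k → Bool}
    (hτ : ∀ v, τ (f v) = s v) (hτ' : ∀ v, τ' (g v) = s v) : Reach G f g := by
  classical
  -- By symmetry, a permutation can place the `true`-side colours of `f` among those of `g`. The
  -- mixture `h` below is then reached from either colouring by recolouring one side.
  wlog hle : (Finset.univ.filter fun i => τ i = true).card ≤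
      (Finset.univ.filter fun i => τ' i = true).card generalizing f g τ τ'
  · exact (this hg hf hτ' hτ (le_of_not_ge hle)).symm
  obtain ⟨σ, hσ⟩ := exists_perm_of_card_le hle
  simp only [Finset.mem_filter, Finset.mem_univ, true_and] at hσ
  let h : V → Fin k := fun v => if s v = true then σ (f v) else g v
  have h1 : Reach G (σ ∘ f) h := by
    refine hH.reach (S := Finset.univ.filter fun v => s v = false)
      (P := Finset.univ.filter fun i => τ (σ.symm i) = false) ?_ (hf.perm σ) ?_ ?_ ?_
    · intro u hu v hv
      simp only [Finset.mem_filter, Finset.mem_univ, true_and] at hu hv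
      exact ⟨fun h => ⟨h, hu.trans hv.symm⟩, fun h => h.1⟩
    · intro v
      simp [hτ]
    · refine ⟨fun u hu => ?_, fun u hu v hv huv => ?_⟩
      · simp only [Finset.mem_filter, Finset.mem_univ, true_and] at hu ⊢
        simp only [h, hu, Bool.false_eq_true, if_false]
        by_contra hcon
        have := hσ _ (Bool.eq_true_of_not_eq_false hcon)
        rw [Equiv.apply_symm_apply, hτ', hu] at this
        exact Bool.noConfusion this
      · simp only [Finset.mem_filter, Finset.mem_univ, true_and] at hu hv
        simp only [h, hu, hv, Bool.false_eq_true, if_false]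
        exact hg huv.1
    · intro v hv
      simp only [Finset.mem_filter, Finset.mem_univ, true_and, Bool.not_eq_false] at hv
      simp [h, hv]
  have h2 : Reach G g h := by
    refine hH.reach (S := Finset.univ.filter fun v => s v = true)
      (P := Finset.univ.filter fun i => τ' i = true) ?_ hg ?_ ?_ ?_
    · intro u hu v hv
      simp only [Finset.mem_filter, Finset.mem_univ, true_and] at hu hv
      exact ⟨fun h => ⟨h, hu.trans hv.symm⟩, fun h => h.1⟩
    · intro v
      simp [hτ']
    · refine ⟨fun u hu => ?_, fun u hu v hv huv => ?_⟩
      · simp only [Finset.mem_filter, Finset.mem_univ, true_and] at hu ⊢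
        simp only [h, hu, if_true]
        exact hσ _ (by rw [hτ, hu])
      · simp only [Finset.mem_filter, Finset.mem_univ, true_and] at hu hv
        simp only [h, hu, hv, if_true]
        exact fun h' => hf huv.1 (σ.injective h')
    · intro v hv
      simp only [Finset.mem_filter, Finset.mem_univ, true_and] at hv
      simp [h, hv]
  exact (hf.reach_perm σ).trans (h1.trans h2.symm)

/-- If a vertex `u` cannot be added to a two-coloured part of a sparse graph, then some walk
`u a b z` leaves the neighbourhood of `u` after `a` and alternates between the two colours. -/
theorem Sparse.exists_alternating_walk [Fintype V] [DecidableEq V] {H : SimpleGraph V}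
    (hH : Sparse H) {f : V → Fin k} (hf : Proper H f) {x x' : Fin k} (hx : x ≠ x') {u : V}
    (hu : f u ≠ x ∧ f u ≠ x')
    (hno : ¬ ∃ g, ProperOn H (insert u (Finset.univ.filter fun v => f v = x ∨ f v = x'))
      {x, x'} g) :
    ∃ a b z, H.Adj u a ∧ H.Adj a b ∧ H.Adj b z ∧ ¬ H.Adj u b ∧ ¬ H.Adj u z ∧
      f a = x ∧ f b = x' ∧ f z = x := by
  classical
  by_contra hcon
  push Not at hcon
  have htf := hH.triangleFree
  -- `R` is the new class `x`: insert `u`, expel its `x`-coloured neighbours to `x'`, and take in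
  -- their `x'`-coloured neighbours. Without the walk sought, no further conflict arises.
  let R : V → Prop := fun v =>
    v = u ∨ (f v = x ∧ ¬ H.Adj u v) ∨ (f v = x' ∧ ∃ a, H.Adj u a ∧ f a = x ∧ H.Adj a v)
  have hR₁ : ∀ v w, H.Adj v w → R v → ¬ R w := by
    have hone : ∀ w, H.Adj u w → ¬ R w := by
      rintro w huw (rfl | ⟨-, h⟩ | ⟨-, a, h1, -, h3⟩)
      · exact huw.ne rfl
      · exact h huw
      · exact htf h1 h3 huw
    have htwo : ∀ v w, H.Adj v w → (f v = x' ∧ ∃ a, H.Adj u a ∧ f a = x ∧ H.Adj a v) →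
        (f w = x ∧ ¬ H.Adj u w) → False := by
      rintro v w hvw ⟨h1, a, h2, h3, h4⟩ ⟨h5, h6⟩
      exact hcon a v w h2 h4 hvw (htf h2 h4) h6 h3 h1 h5
    rintro v w hvw hv hw
    have h1 := hf hvw
    rcases hv with rfl | hv | hv
    · exact hone w hvw hw
    · rcases hw with rfl | hw | hw
      · exact hv.2 hvw.symm
      · exact h1 (hv.1.trans hw.1.symm)
      · exact htwo w v hvw.symm hw hv
    · rcases hw with rfl | hw | hw
      · exact hone v hvw.symm (Or.inr (Or.inr hv))
      · exact htwo v w hvw hv hw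
      · exact h1 (hv.1.trans hw.1.symm)
  have hR₂ : ∀ v w, H.Adj v w → (v = u ∨ f v = x ∨ f v = x') → (w = u ∨ f w = x ∨ f w = x') →
      ¬ R v → R w := by
    intro v w hvw hv hw hnv
    by_contra hnw
    have h1 := hf hvw
    simp only [R, not_or, not_and, not_not, not_exists] at hnv hnw
    rcases hv with hv | hv | hv
    · exact hnv.1 hv
    · rcases hw with hw | hw | hw
      · exact hnw.1 hw
      · exact h1 (hv.trans hw.symm)
      · exact hnw.2.2 hw v (hnv.2.1 hv) hv hvw
    · rcases hw with hw | hw | hw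
      · exact hnw.1 hw
      · exact hnv.2.2 hv w (hnw.2.1 hw) hw hvw.symm
      · exact h1 (hv.trans hw.symm)
  refine hno ⟨fun v => if R v then x else x', fun v _ => ?_, fun v hv w hw hvw => ?_⟩
  · dsimp only
    split_ifs <;> simp
  · simp only [Finset.mem_insert, Finset.mem_filter, Finset.mem_univ, true_and] at hv hw
    dsimp only
    by_cases h : R v
    · rw [if_pos h, if_neg (hR₁ v w hvw h)]
      exact hx
    · rw [if_neg h, if_pos (hR₂ v w hvw hv hw h)]
      exact hx.symm

end Sides

/-! ### The rigid configuration with four colours -/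

section FourColours

variable {V : Type*} {G : SimpleGraph V} {k : ℕ}

/-- From `f` one reaches a colouring in which all but one of the colour classes are one-sided. -/
def NearlyPurifiable (G : SimpleGraph V) (s : V → Bool) (f : V → Fin k) : Prop :=
  ∃ g, Reach G f g ∧ ∃ m, ∀ i ≠ m, ∃ b, ∀ v, g v = i → s v = b

theorem NearlyPurifiable.of_reach {s : V → Bool} {f g : V → Fin k} (h : Reach G f g)
    (hg : NearlyPurifiable G s g) : NearlyPurifiable G s f := by
  obtain ⟨g', h1, h2⟩ := hg
  exact ⟨g', h.trans h1, h2⟩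

/-- A four-colouring with two one-sided colours `x`, `y` on different sides, and two colours
`i`, `j` with one vertex on either side, in which the same-sided edges are `u₁u₂` and one edge
between each of `u₁`, `u₂`, `w₁`, `w₂` and the one-sided colour of its side. -/
structure TightConfig (G : SimpleGraph V) (s : V → Bool) (f : V → Fin k) (i j x y : Fin k)
    (b : Bool) (u₁ u₂ w₁ w₂ a₁ a₂ b₁ b₂ : V) : Prop where
  proper : Proper G f
  colours : ∀ m : Fin k, m = i ∨ m = j ∨ m = x ∨ m = y
  ij : i ≠ j
  ix : i ≠ x
  iy : i ≠ y
  jx : j ≠ x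
  jy : j ≠ y
  xy : x ≠ y
  side_x : ∀ v, f v = x → s v = b
  side_y : ∀ v, f v = y → s v = !b
  f_i : ∀ v, f v = i ↔ v = u₁ ∨ v = w₁
  f_j : ∀ v, f v = j ↔ v = u₂ ∨ v = w₂
  su₁ : s u₁ = b
  su₂ : s u₂ = b
  sw₁ : s w₁ = !b
  sw₂ : s w₂ = !b
  uu : G.Adj u₁ u₂
  ww : ¬ G.Adj w₁ w₂
  fa₁ : f a₁ = x
  fa₂ : f a₂ = x
  fb₁ : f b₁ = y
  fb₂ : f b₂ = y
  ua₁ : G.Adj u₁ a₁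
  ua₂ : G.Adj u₂ a₂
  wb₁ : G.Adj w₁ b₁
  wb₂ : G.Adj w₂ b₂
  eq_a₁ : ∀ v, G.Adj u₁ v → f v = x → v = a₁
  eq_a₂ : ∀ v, G.Adj u₂ v → f v = x → v = a₂
  eq_b₁ : ∀ v, G.Adj w₁ v → f v = y → v = b₁
  eq_b₂ : ∀ v, G.Adj w₂ v → f v = y → v = b₂
  aa : a₁ ≠ a₂

namespace TightConfig

variable {s : V → Bool} {f : V → Fin k} {i j x y : Fin k} {b : Bool}
  {u₁ u₂ w₁ w₂ a₁ a₂ b₁ b₂ : V}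

theorem swap (h : TightConfig G s f i j x y b u₁ u₂ w₁ w₂ a₁ a₂ b₁ b₂) :
    TightConfig G s f j i x y b u₂ u₁ w₂ w₁ a₂ a₁ b₂ b₁ where
  proper := h.proper
  colours m := by rcases h.colours m with h | h | h | h <;> simp [h]
  ij := h.ij.symm
  ix := h.jx
  iy := h.jy
  jx := h.ix
  jy := h.iy
  xy := h.xy
  side_x := h.side_x
  side_y := h.side_y
  f_i := h.f_j
  f_j := h.f_i
  su₁ := h.su₂
  su₂ := h.su₁
  sw₁ := h.sw₂
  sw₂ := h.sw₁
  uu := h.uu.symm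
  ww hw := h.ww hw.symm
  fa₁ := h.fa₂
  fa₂ := h.fa₁
  fb₁ := h.fb₂
  fb₂ := h.fb₁
  ua₁ := h.ua₂
  ua₂ := h.ua₁
  wb₁ := h.wb₂
  wb₂ := h.wb₁
  eq_a₁ := h.eq_a₂
  eq_a₂ := h.eq_a₁
  eq_b₁ := h.eq_b₂
  eq_b₂ := h.eq_b₁
  aa := h.aa.symm

/-- Otherwise `w₂` could move to `i`, leaving `u₂` alone in `j`. -/
theorem u₁_w₂ (h : TightConfig G s f i j x y b u₁ u₂ w₁ w₂ a₁ a₂ b₁ b₂)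
    (hn : ¬ NearlyPurifiable G s f) : G.Adj u₁ w₂ := by
  classical
  by_contra hc
  obtain ⟨-, hr⟩ := reach_update h.proper w₂ i fun v hv hvi => by
    rcases (h.f_i v).1 hvi with rfl | rfl
    · exact hc hv.symm
    · exact h.ww hv.symm
  refine hn ⟨_, hr, i, fun m hm => ?_⟩
  have h1 := h.f_j
  have h2 := h.side_x
  have h3 := h.side_y
  have h4 := h.su₂
  rcases h.colours m with rfl | rfl | rfl | rfl
  · exact absurd rfl hm
  · refine ⟨b, fun v hv => ?_⟩
    rw [Function.update_apply] at hv
    grind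
  · refine ⟨b, fun v hv => ?_⟩
    rw [Function.update_apply] at hv
    grind
  · refine ⟨!b, fun v hv => ?_⟩
    rw [Function.update_apply] at hv
    grind

/-- Otherwise `u₁` and `a₁` can exchange the colours `i` and `x`. As `a₂` is the only `x`-neighbour
of `u₂`, no same-sided edge then joins `i` and `j`, and these two classes can be sorted by side. -/
theorem a₁_w₁ (h : TightConfig G s f i j x y b u₁ u₂ w₁ w₂ a₁ a₂ b₁ b₂)
    (hn : ¬ NearlyPurifiable G s f) : G.Adj a₁ w₁ := by
  by_contra hc
  obtain ⟨hf, -, ij, ix, iy, jx, jy, xy, sx, sy, f_i, f_j, su₁, su₂, sw₁, sw₂, uu, ww, fa₁, fa₂,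
    fb₁, fb₂, ua₁, ua₂, wb₁, wb₂, e₁, e₂, -, -, aa⟩ := id h
  have c₁ : ∀ u v, G.Adj u v → f u = i → f v = x →
      ((u = a₁ ∨ u = w₁) ↔ ¬ (v = a₁ ∨ v = w₁)) := by
    intro u v huv hu hv
    have := huv.symm
    grind
  have p₁ := hf.resplit i x (fun v => v = a₁ ∨ v = w₁) c₁
  have r₁ := hf.reach_resplit i x (fun v => v = a₁ ∨ v = w₁) c₁
  have v₁ : ∀ v, resplit f i x (fun v => v = a₁ ∨ v = w₁) v = i ↔ v = a₁ ∨ v = w₁ := by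
    intro v; unfold resplit; grind
  have v₂ : ∀ v, resplit f i x (fun v => v = a₁ ∨ v = w₁) v = j ↔ v = u₂ ∨ v = w₂ := by
    intro v; unfold resplit; grind
  have v₃ : ∀ v, resplit f i x (fun v => v = a₁ ∨ v = w₁) v = x → s v = b := by
    intro v; unfold resplit; grind
  have v₄ : ∀ v, resplit f i x (fun v => v = a₁ ∨ v = w₁) v = y → s v = !b := by
    intro v; unfold resplit; grind
  generalize resplit f i x (fun v => v = a₁ ∨ v = w₁) = g at *
  have r₂ := p₁.reach_resplit i j (fun v => s v = b) (by
    intro u v huv hu hv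
    have := huv.symm
    have := sx a₁ fa₁
    grind)
  refine hn ⟨_, r₁.trans r₂, i, fun m hm => ?_⟩
  rcases h.colours m with rfl | rfl | rfl | rfl
  · exact absurd rfl hm
  · refine ⟨!b, fun v => ?_⟩
    unfold resplit; grind
  · refine ⟨b, fun v => ?_⟩
    unfold resplit; grind
  · refine ⟨!b, fun v => ?_⟩
    unfold resplit; grind

/-- Otherwise let the `x`-neighbours of `w₁` form the class `i`, which is proper because `a₁` is
among them. Since `a₂` is not, `u₂` can join them, and only `x` stays mixed. -/
theorem a₂_w₁ (h : TightConfig G s f i j x y b u₁ u₂ w₁ w₂ a₁ a₂ b₁ b₂)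
    (hn : ¬ NearlyPurifiable G s f) : G.Adj a₂ w₁ := by
  classical
  have h₁ := h.a₁_w₁ hn
  by_contra hc
  obtain ⟨hf, -, ij, ix, iy, jx, jy, xy, sx, sy, f_i, f_j, su₁, su₂, sw₁, sw₂, uu, ww, fa₁, fa₂,
    fb₁, fb₂, ua₁, ua₂, wb₁, wb₂, e₁, e₂, -, -, aa⟩ := id h
  have c₁ : ∀ u v, G.Adj u v → f u = i → f v = x →
      ((f u = x ∧ G.Adj u w₁) ↔ ¬ (f v = x ∧ G.Adj v w₁)) := by
    intro u v huv hu hv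
    have := huv.symm
    grind
  have p₁ := hf.resplit i x (fun v => f v = x ∧ G.Adj v w₁) c₁
  have r₁ := hf.reach_resplit i x (fun v => f v = x ∧ G.Adj v w₁) c₁
  have v₁ : ∀ v, resplit f i x (fun v => f v = x ∧ G.Adj v w₁) v = i ↔ f v = x ∧ G.Adj v w₁ := by
    intro v; unfold resplit; grind
  have v₂ : ∀ v, resplit f i x (fun v => f v = x ∧ G.Adj v w₁) v = j ↔ v = u₂ ∨ v = w₂ := by
    intro v; unfold resplit; grind
  have v₄ : ∀ v, resplit f i x (fun v => f v = x ∧ G.Adj v w₁) v = y → s v = !b := by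
    intro v; unfold resplit; grind
  generalize resplit f i x (fun v => f v = x ∧ G.Adj v w₁) = g at *
  obtain ⟨-, r₂⟩ := reach_update p₁ u₂ i fun v hv hvi => by
    grind
  refine hn ⟨_, r₁.trans r₂, x, fun m hm => ?_⟩
  rcases h.colours m with rfl | rfl | rfl | rfl
  · refine ⟨b, fun v hv => ?_⟩
    rw [Function.update_apply] at hv
    grind
  · refine ⟨!b, fun v hv => ?_⟩
    rw [Function.update_apply] at hv
    grind
  · exact absurd rfl hm
  · refine ⟨!b, fun v hv => ?_⟩
    rw [Function.update_apply] at hv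
    grind

/-- Otherwise `w₁` and `b₁` can exchange `i` and `y`. If `b₁ = b₂`, this frees `w₂` for `y`. If not,
the result is again tight, and the adjacencies forced in both configurations make `u₂`, `a₂`, `w₁`,
`b₁` a complete graph, contradicting `ψ`. -/
theorem b₁_u₁ (h : TightConfig G s f i j x y b u₁ u₂ w₁ w₂ a₁ a₂ b₁ b₂)
    (hn : ¬ NearlyPurifiable G s f) {ψ : V → Fin 3} (hψ : Proper G ψ) : G.Adj b₁ u₁ := by
  classical
  by_contra hc
  obtain ⟨hf, hcol, ij, ix, iy, jx, jy, xy, sx, sy, f_i, f_j, su₁, su₂, sw₁, sw₂, uu, ww, fa₁, fa₂,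
    fb₁, fb₂, ua₁, ua₂, wb₁, wb₂, ea₁, ea₂, eb₁, eb₂, aa⟩ := id h
  have c₁ : ∀ u v, G.Adj u v → f u = i → f v = y →
      ((u = b₁ ∨ u = u₁) ↔ ¬ (v = b₁ ∨ v = u₁)) := by
    intro u v huv hu hv
    have := huv.symm
    grind
  have p₁ := hf.resplit i y (fun v => v = b₁ ∨ v = u₁) c₁
  have r₁ := hf.reach_resplit i y (fun v => v = b₁ ∨ v = u₁) c₁
  have v₁ : ∀ v, resplit f i y (fun v => v = b₁ ∨ v = u₁) v = i ↔ v = u₁ ∨ v = b₁ := by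
    intro v; unfold resplit; grind
  have v₂ : ∀ v, resplit f i y (fun v => v = b₁ ∨ v = u₁) v = j ↔ v = u₂ ∨ v = w₂ := by
    intro v; unfold resplit; grind
  have v₃ : ∀ v, resplit f i y (fun v => v = b₁ ∨ v = u₁) v = x ↔ f v = x := by
    intro v; unfold resplit; grind
  have v₄ : ∀ v, resplit f i y (fun v => v = b₁ ∨ v = u₁) v = y ↔
      v = w₁ ∨ (f v = y ∧ v ≠ b₁) := by
    intro v; unfold resplit; grind
  generalize resplit f i y (fun v => v = b₁ ∨ v = u₁) = g at *
  have hng : ¬ NearlyPurifiable G s g := fun hg => hn (hg.of_reach r₁)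
  by_cases hbb : b₁ = b₂
  · obtain ⟨-, r₂⟩ := reach_update p₁ w₂ y fun v hv hvi => by
      have := hv.symm
      grind
    refine hng ⟨_, r₂, i, fun m hm => ?_⟩
    rcases hcol m with rfl | rfl | rfl | rfl
    · exact absurd rfl hm
    · refine ⟨b, fun v hv => ?_⟩
      rw [Function.update_apply] at hv
      grind
    · refine ⟨b, fun v hv => ?_⟩
      rw [Function.update_apply] at hv
      grind
    · refine ⟨!b, fun v hv => ?_⟩
      rw [Function.update_apply] at hv
      grind
  · have h' : TightConfig G s g i j x y b u₁ u₂ b₁ w₂ a₁ a₂ w₁ b₂ :=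
      { proper := p₁, colours := hcol, ij := ij, ix := ix, iy := iy, jx := jx, jy := jy, xy := xy
        side_x := by grind
        side_y := by grind
        f_i := v₁, f_j := v₂, su₁ := su₁, su₂ := su₂
        sw₁ := sy _ fb₁
        sw₂ := sw₂, uu := uu
        ww := fun hw => hbb (eb₂ _ hw.symm fb₁)
        fa₁ := (v₃ _).2 fa₁
        fa₂ := (v₃ _).2 fa₂
        fb₁ := (v₄ _).2 (Or.inl rfl)
        fb₂ := (v₄ _).2 (Or.inr ⟨fb₂, Ne.symm hbb⟩)
        ua₁ := ua₁, ua₂ := ua₂, wb₁ := wb₁.symm, wb₂ := wb₂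
        eq_a₁ := fun v hv hx => ea₁ v hv ((v₃ v).1 hx)
        eq_a₂ := fun v hv hx => ea₂ v hv ((v₃ v).1 hx)
        eq_b₁ := fun v hv hx => by
          rcases (v₄ v).1 hx with h | ⟨h, -⟩
          · exact h
          · exact absurd (fb₁.trans h.symm) (hf hv)
        eq_b₂ := fun v hv hx => by
          rcases (v₄ v).1 hx with h | ⟨h, -⟩
          · exact absurd (h ▸ hv.symm) ww
          · exact eb₂ v hv h
        aa := aa }
    have e1 := hψ (h.a₂_w₁ hn)
    have e2 := hψ (h'.a₂_w₁ hng)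
    have e3 := hψ (h.swap.u₁_w₂ hn)
    have e4 := hψ (h'.swap.u₁_w₂ hng)
    have e5 := hψ wb₁
    have e6 := hψ ua₂
    omega

/-- As for `a₂_w₁` on the other side: let the `y`-neighbours of `u₁` form the class `i`, which `w₂`
can then join. -/
theorem b₂_u₁ (h : TightConfig G s f i j x y b u₁ u₂ w₁ w₂ a₁ a₂ b₁ b₂)
    (hn : ¬ NearlyPurifiable G s f) {ψ : V → Fin 3} (hψ : Proper G ψ) : G.Adj b₂ u₁ := by
  classical
  have h₁ := h.b₁_u₁ hn hψ
  by_contra hc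
  obtain ⟨hf, -, ij, ix, iy, jx, jy, xy, sx, sy, f_i, f_j, su₁, su₂, sw₁, sw₂, uu, ww, fa₁, fa₂,
    fb₁, fb₂, ua₁, ua₂, wb₁, wb₂, -, -, eb₁, eb₂, aa⟩ := id h
  have c₁ : ∀ u v, G.Adj u v → f u = i → f v = y →
      ((f u = y ∧ G.Adj u u₁) ↔ ¬ (f v = y ∧ G.Adj v u₁)) := by
    intro u v huv hu hv
    have := huv.symm
    grind
  have p₁ := hf.resplit i y (fun v => f v = y ∧ G.Adj v u₁) c₁
  have r₁ := hf.reach_resplit i y (fun v => f v = y ∧ G.Adj v u₁) c₁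
  have v₁ : ∀ v, resplit f i y (fun v => f v = y ∧ G.Adj v u₁) v = i ↔ f v = y ∧ G.Adj v u₁ := by
    intro v; unfold resplit; grind
  have v₂ : ∀ v, resplit f i y (fun v => f v = y ∧ G.Adj v u₁) v = j ↔ v = u₂ ∨ v = w₂ := by
    intro v; unfold resplit; grind
  have v₄ : ∀ v, resplit f i y (fun v => f v = y ∧ G.Adj v u₁) v = x → s v = b := by
    intro v; unfold resplit; grind
  generalize resplit f i y (fun v => f v = y ∧ G.Adj v u₁) = g at *
  obtain ⟨-, r₂⟩ := reach_update p₁ w₂ i fun v hv hvi => by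
    grind
  refine hn ⟨_, r₁.trans r₂, y, fun m hm => ?_⟩
  rcases h.colours m with rfl | rfl | rfl | rfl
  · refine ⟨!b, fun v hv => ?_⟩
    rw [Function.update_apply] at hv
    grind
  · refine ⟨b, fun v hv => ?_⟩
    rw [Function.update_apply] at hv
    grind
  · refine ⟨b, fun v hv => ?_⟩
    rw [Function.update_apply] at hv
    grind
  · exact absurd rfl hm

theorem nearlyPurifiable (h : TightConfig G s f i j x y b u₁ u₂ w₁ w₂ a₁ a₂ b₁ b₂)
    {ψ : V → Fin 3} (hψ : Proper G ψ) : NearlyPurifiable G s f := by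
  classical
  by_contra hn
  have b₁u₁ := h.b₁_u₁ hn hψ
  have b₂u₁ := h.b₂_u₁ hn hψ
  have b₂u₂ := h.swap.b₁_u₁ hn hψ
  have b₁u₂ := h.swap.b₂_u₁ hn hψ
  have a₁w₁ := h.a₁_w₁ hn
  have a₂w₂ := h.swap.a₁_w₁ hn
  have a₁w₂ := h.swap.a₂_w₁ hn
  have a₂w₁ := h.a₂_w₁ hn
  -- Under `ψ` the vertices `u₁`, `u₂`, `b₁` have three different colours, `w₁` agrees with `u₁`,
  -- and `w₂` with `u₂`. So `a` and `b` both get the colour of `b₁`.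
  have key : ∀ a b, f a = x → G.Adj a w₁ → G.Adj a w₂ → f b = y → G.Adj b u₁ → G.Adj b u₂ →
      ¬ G.Adj a b := by
    intro a b _ h1 h2 _ h3 h4 h5
    have := hψ h1
    have := hψ h2
    have := hψ h3
    have := hψ h4
    have := hψ h5
    have := hψ h.uu
    have := hψ h.wb₁
    have := hψ h.wb₂
    have := hψ b₁u₁
    have := hψ b₁u₂
    have := hψ b₂u₁
    have := hψ b₂u₂
    have := hψ (h.u₁_w₂ hn)
    have := hψ (h.swap.u₁_w₂ hn)
    omega
  obtain ⟨hf, hcol, ij, ix, iy, jx, jy, xy, sx, sy, f_i, f_j, su₁, su₂, sw₁, sw₂, uu, ww, fa₁, fa₂,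
    fb₁, fb₂, ua₁, ua₂, wb₁, wb₂, ea₁, ea₂, eb₁, eb₂, aa⟩ := id h
  -- Shrink `x` to the common neighbours of `w₁` and `w₂`, sending the others to `i` and then to
  -- `j`.
  have c₁ : ∀ u v, G.Adj u v → f u = x → f v = i → ((f u = x ∧ G.Adj u w₁) ↔
      ¬ (f v = x ∧ G.Adj v w₁)) := by
    intro u v huv hu hv
    have := huv.symm
    grind
  have p₁ := hf.resplit x i (fun v => f v = x ∧ G.Adj v w₁) c₁
  have r₁ := hf.reach_resplit x i (fun v => f v = x ∧ G.Adj v w₁) c₁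
  have x₁ : ∀ v, resplit f x i (fun v => f v = x ∧ G.Adj v w₁) v = x ↔ f v = x ∧ G.Adj v w₁ := by
    intro v; unfold resplit; grind
  have i₁ : ∀ v, resplit f x i (fun v => f v = x ∧ G.Adj v w₁) v = i → f v = x ∨ f v = i := by
    intro v; unfold resplit; grind
  have j₁ : ∀ v, resplit f x i (fun v => f v = x ∧ G.Adj v w₁) v = j ↔ f v = j := by
    intro v; unfold resplit; grind
  have y₁ : ∀ v, resplit f x i (fun v => f v = x ∧ G.Adj v w₁) v = y ↔ f v = y := by
    intro v; unfold resplit; grind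
  generalize resplit f x i (fun v => f v = x ∧ G.Adj v w₁) = g₁ at *
  have c₂ : ∀ u v, G.Adj u v → g₁ u = x → g₁ v = j → ((f u = x ∧ G.Adj u w₂) ↔
      ¬ (f v = x ∧ G.Adj v w₂)) := by
    intro u v huv hu hv
    have := huv.symm
    grind
  have p₂ := p₁.resplit x j (fun v => f v = x ∧ G.Adj v w₂) c₂
  have r₂ := p₁.reach_resplit x j (fun v => f v = x ∧ G.Adj v w₂) c₂
  have x₂ : ∀ v, resplit g₁ x j (fun v => f v = x ∧ G.Adj v w₂) v = x ↔
      f v = x ∧ G.Adj v w₁ ∧ G.Adj v w₂ := by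
    intro v; unfold resplit; grind
  have i₂ : ∀ v, resplit g₁ x j (fun v => f v = x ∧ G.Adj v w₂) v = i → f v = x ∨ f v = i := by
    intro v; unfold resplit; grind
  have j₂ : ∀ v, resplit g₁ x j (fun v => f v = x ∧ G.Adj v w₂) v = j → f v = x ∨ f v = j := by
    intro v; unfold resplit; grind
  have y₂ : ∀ v, resplit g₁ x j (fun v => f v = x ∧ G.Adj v w₂) v = y ↔ f v = y := by
    intro v; unfold resplit; grind
  generalize resplit g₁ x j (fun v => f v = x ∧ G.Adj v w₂) = g₂ at *
  -- By `key`, `x` can absorb the common `y`-neighbours of `u₁` and `u₂`. These include `b₁` and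
  -- `b₂`, so `w₁` and `w₂` become free for `y`.
  have c₃ : ∀ u v, G.Adj u v → g₂ u = x → g₂ v = y →
      ((f u = x ∨ (f u = y ∧ G.Adj u u₁ ∧ G.Adj u u₂)) ↔
      ¬ (f v = x ∨ (f v = y ∧ G.Adj v u₁ ∧ G.Adj v u₂))) := by
    intro u v huv hu hv
    have := key u v
    grind
  have p₃ := p₂.resplit x y (fun v => f v = x ∨ (f v = y ∧ G.Adj v u₁ ∧ G.Adj v u₂)) c₃
  have r₃ := p₂.reach_resplit x y (fun v => f v = x ∨ (f v = y ∧ G.Adj v u₁ ∧ G.Adj v u₂)) c₃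
  have i₃ : ∀ v, resplit g₂ x y (fun v => f v = x ∨ (f v = y ∧ G.Adj v u₁ ∧ G.Adj v u₂)) v = i →
      f v = x ∨ f v = i := by
    intro v; unfold resplit; grind
  have j₃ : ∀ v, resplit g₂ x y (fun v => f v = x ∨ (f v = y ∧ G.Adj v u₁ ∧ G.Adj v u₂)) v = j →
      f v = x ∨ f v = j := by
    intro v; unfold resplit; grind
  have y₃ : ∀ v, resplit g₂ x y (fun v => f v = x ∨ (f v = y ∧ G.Adj v u₁ ∧ G.Adj v u₂)) v = y →
      f v = y ∧ ¬ (G.Adj v u₁ ∧ G.Adj v u₂) := by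
    intro v; unfold resplit; grind
  generalize resplit g₂ x y (fun v => f v = x ∨ (f v = y ∧ G.Adj v u₁ ∧ G.Adj v u₂)) = g₃ at *
  obtain ⟨p₄, r₄⟩ := reach_update p₃ w₁ y fun v hv hvy => by grind
  obtain ⟨-, r₅⟩ := reach_update p₄ w₂ y fun v hv hvy => by
    rw [Function.update_apply] at hvy
    have := hv.symm
    grind
  refine hn ⟨_, r₁.trans (r₂.trans (r₃.trans (r₄.trans r₅))), x, fun m hm => ?_⟩
  rcases hcol m with rfl | rfl | rfl | rfl
  · refine ⟨b, fun v hv => ?_⟩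
    rw [Function.update_apply, Function.update_apply] at hv
    grind
  · refine ⟨b, fun v hv => ?_⟩
    rw [Function.update_apply, Function.update_apply] at hv
    grind
  · exact absurd rfl hm
  · refine ⟨!b, fun v hv => ?_⟩
    rw [Function.update_apply, Function.update_apply] at hv
    grind

end TightConfig

end FourColours

/-! ### Labelled colourings and edge counting -/

section Labels

variable {V : Type*} {G : SimpleGraph V} {s : V → Bool} {k : ℕ}

/-- A proper colouring, with the label `some b` on some colours used on side `b` only. -/
structure Labelled (G : SimpleGraph V) (s : V → Bool) (f : V → Fin k) (τ : Fin k → Option Bool) :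
    Prop where
  proper : Proper G f
  side : ∀ v b, τ (f v) = some b → s v = b

/-- The colours without a label. -/
def unlabelled (τ : Fin k → Option Bool) : Finset (Fin k) := Finset.univ.filter fun i => τ i = none

/-- The vertices whose colour has no label. -/
def unlabelledVertices [Fintype V] (f : V → Fin k) (τ : Fin k → Option Bool) : Finset V :=
  Finset.univ.filter fun v => τ (f v) = none

/-- One can reach a labelled colouring with fewer unlabelled colours, or as many of them on fewer
vertices. -/
def Improvable [Fintype V] (G : SimpleGraph V) (s : V → Bool) (f : V → Fin k) (τ : Fin k → Option Bool) :
    Prop :=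
  ∃ g τ', Reach G f g ∧ Labelled G s g τ' ∧ ((unlabelled τ').card < (unlabelled τ).card ∨
    ((unlabelled τ').card = (unlabelled τ).card ∧
      (unlabelledVertices g τ').card < (unlabelledVertices f τ).card))

/-- A same-sided edge between the colours `i` and `j`. -/
def HasEdge (G : SimpleGraph V) (s : V → Bool) (f : V → Fin k) (i j : Fin k) : Prop :=
  ∃ u v, (sameSide G s).Adj u v ∧ f u = i ∧ f v = j

theorem bool_eq_or_eq_not (a b : Bool) : a = b ∨ a = !b := by
  cases a <;> cases b <;> simp

theorem HasEdge.symm {f : V → Fin k} {i j : Fin k} (h : HasEdge G s f i j) :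
    HasEdge G s f j i := by
  obtain ⟨u, v, huv, hu, hv⟩ := h
  exact ⟨v, u, huv.symm, hv, hu⟩

namespace Labelled

variable [Fintype V] {f : V → Fin k} {τ : Fin k → Option Bool}

theorem improvable_of_lt {g : V → Fin k} {τ' : Fin k → Option Bool} (hr : Reach G f g)
    (hg : Labelled G s g τ') {i : Fin k} (hi : τ i = none) (hi' : τ' i ≠ none)
    (hsub : ∀ m, τ' m = none → τ m = none) : Improvable G s f τ := by
  refine ⟨g, τ', hr, hg, Or.inl (Finset.card_lt_card ⟨fun m hm => ?_, fun h => ?_⟩)⟩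
  · simp only [unlabelled, Finset.mem_filter, Finset.mem_univ, true_and] at hm ⊢
    exact hsub m hm
  · have : i ∈ unlabelled τ' := h (by simp [unlabelled, hi])
    simp only [unlabelled, Finset.mem_filter, Finset.mem_univ, true_and] at this
    exact hi' this

theorem exists_side (h : Labelled G s f τ) (hn : ¬ Improvable G s f τ) {i : Fin k}
    (hi : τ i = none) (b : Bool) : ∃ v, f v = i ∧ s v = b := by
  by_contra hc
  push Not at hc
  refine hn (improvable_of_lt (Reach.refl f) (τ' := Function.update τ i (some !b))
    ⟨h.proper, fun v c hv => ?_⟩ hi (by simp) fun m hm => ?_)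
  · by_cases hvi : f v = i
    · rw [hvi, Function.update_self] at hv
      rw [← Option.some.inj hv]
      exact (bool_eq_or_eq_not (s v) b).resolve_left (hc v hvi)
    · rw [Function.update_of_ne hvi] at hv
      exact h.side v c hv
  · by_cases hmi : m = i
    · exact hmi ▸ hi
    · rwa [Function.update_of_ne hmi] at hm

/-- Without such an edge the two classes can be redistributed by side, and both colours labelled. -/
theorem hasEdge_of_unlabelled (h : Labelled G s f τ) (hn : ¬ Improvable G s f τ) {i j : Fin k}
    (hi : τ i = none) (hij : i ≠ j) : HasEdge G s f i j := by
  by_contra hc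
  have hc' : ∀ u v, G.Adj u v → f u = j → f v = i → s u ≠ s v := fun u v huv hu hv hs =>
    hc ⟨v, u, ⟨huv.symm, hs.symm⟩, hv, hu⟩
  obtain ⟨b, hb⟩ : ∃ b, τ j = none ∨ τ j = some b := by
    cases τ j with
    | none => exact ⟨true, Or.inl rfl⟩
    | some b => exact ⟨b, Or.inr rfl⟩
  have hD : ∀ u v, G.Adj u v → f u = j → f v = i → (s u = b ↔ ¬ s v = b) := by
    intro u v huv hu hv
    have := hc' u v huv hu hv
    have h1 := bool_eq_or_eq_not (s u) b
    have h2 := bool_eq_or_eq_not (s v) b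
    grind
  refine hn (improvable_of_lt (h.proper.reach_resplit j i (fun v => s v = b) hD)
    (τ' := fun m => if m = j then some b else if m = i then some (!b) else τ m)
    ⟨h.proper.resplit j i _ hD, fun v c hv => ?_⟩ hi (by simp [hij]) fun m hm => ?_)
  · have := h.side v c
    have := bool_eq_or_eq_not (s v) b
    unfold resplit at hv
    grind
  · grind

/-- Without such an edge `j` can be merged into `i`. The emptied `j` then takes over the part of `m`
on side `!b`, so that `m` can be labelled too. -/
theorem hasEdge_of_same_label (h : Labelled G s f τ) (hn : ¬ Improvable G s f τ) {i j m : Fin k}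
    {b : Bool} (hi : τ i = some b) (hj : τ j = some b) (hm : τ m = none) (hij : i ≠ j) :
    HasEdge G s f i j := by
  by_contra hc
  have hjm : j ≠ m := by rintro rfl; simp [hj] at hm
  have him : i ≠ m := by rintro rfl; simp [hi] at hm
  have hD : ∀ u v, G.Adj u v → f u = i → f v = j → (True ↔ ¬ True) := fun u v huv hu hv =>
    absurd ⟨u, v, ⟨huv, (h.side u b (hu ▸ hi)).trans (h.side v b (hv ▸ hj)).symm⟩, hu, hv⟩ hc
  have p₁ := h.proper.resplit i j (fun _ => True) hD
  have r₁ := h.proper.reach_resplit i j (fun _ => True) hD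
  have v₁ : ∀ v, resplit f i j (fun _ => True) v ≠ j := by
    intro v; unfold resplit; grind
  have v₂ : ∀ v, resplit f i j (fun _ => True) v = i → s v = b := by
    intro v hv
    have := h.side v b
    unfold resplit at hv; grind
  have v₃ : ∀ v, resplit f i j (fun _ => True) v ≠ i → resplit f i j (fun _ => True) v = f v := by
    intro v; unfold resplit; grind
  generalize resplit f i j (fun _ => True) = g at *
  have hD' : ∀ u v, G.Adj u v → g u = j → g v = m → (s u = !b ↔ ¬ s v = !b) :=
    fun u v _ hu => absurd hu (v₁ u)
  refine hn (improvable_of_lt (r₁.trans (p₁.reach_resplit j m (fun v => s v = !b) hD'))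
    (τ' := fun l => if l = j then some (!b) else if l = m then some b else τ l)
    ⟨p₁.resplit j m _ hD', fun v c hv => ?_⟩ hm (by simp [hjm.symm]) fun l hl => ?_)
  · have h1 := h.side v c
    have h2 := v₁ v
    have h3 := v₂ v
    have h4 := v₃ v
    have h5 := bool_eq_or_eq_not (s v) b
    unfold resplit at hv
    grind
  · grind

theorem improvable_of_recolour [DecidableEq V] (h : Labelled G s f τ) {u : V}
    (hu : τ (f u) = none) {i : Fin k} (hi : τ i = some (s u))
    (hno : ∀ a, (sameSide G s).Adj u a → f a ≠ i) : Improvable G s f τ := by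
  obtain ⟨hp, hr⟩ := reach_update h.proper u i fun v huv hv =>
    hno v ⟨huv, (h.side v (s u) (hv ▸ hi)).symm⟩ hv
  refine ⟨_, τ, hr, ⟨hp, fun v b hv => ?_⟩, Or.inr ⟨rfl, Finset.card_lt_card ⟨fun v hv => ?_,
    fun hsub => ?_⟩⟩⟩
  · by_cases hvu : v = u
    · subst hvu
      rw [Function.update_self, hi] at hv
      exact Option.some.inj hv
    · rw [Function.update_of_ne hvu] at hv
      exact h.side v b hv
  · simp only [unlabelledVertices, Finset.mem_filter, Finset.mem_univ, true_and] at hv ⊢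
    by_cases hvu : v = u
    · exact hvu ▸ hu
    · rwa [Function.update_of_ne hvu] at hv
  · have : u ∈ unlabelledVertices (Function.update f u i) τ :=
      hsub (by simp [unlabelledVertices, hu])
    simp [unlabelledVertices, hi] at this

theorem exists_neighbour (h : Labelled G s f τ) (hn : ¬ Improvable G s f τ) {u : V}
    (hu : τ (f u) = none) {i : Fin k} (hi : τ i = some (s u)) :
    ∃ a, (sameSide G s).Adj u a ∧ f a = i := by
  classical
  by_contra hc
  push Not at hc
  exact hn (h.improvable_of_recolour hu hi hc)

/-- Colours labelled with the side of `u` occur nowhere else, so `Sparse.reach` recolours their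
vertices as in `g`; then `u` can join them, which leaves fewer unlabelled vertices. -/
theorem not_properOn_insert [DecidableEq V] (h : Labelled G s f τ) (hn : ¬ Improvable G s f τ)
    (hH : Sparse (sameSide G s)) {u : V} (hu : τ (f u) = none) :
    ¬ ∃ g, ProperOn (sameSide G s) (insert u (Finset.univ.filter fun v => τ (f v) = some (s u)))
      (Finset.univ.filter fun i => τ i = some (s u)) g := by
  rintro ⟨g, hg⟩
  let g' : V → Fin k := fun v => if τ (f v) = some (s u) then g v else f v
  have hr : Reach G f g' := by
    refine hH.reach (S := Finset.univ.filter fun v => τ (f v) = some (s u))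
      (P := Finset.univ.filter fun i => τ i = some (s u)) ?_ h.proper (by simp) ?_ ?_
    · intro v hv w hw
      simp only [Finset.mem_filter, Finset.mem_univ, true_and] at hv hw
      exact ⟨fun hvw => ⟨hvw, (h.side v _ hv).trans (h.side w _ hw).symm⟩, fun hvw => hvw.1⟩
    · have := hg.mono (Finset.subset_insert u _)
      refine ⟨fun v hv => ?_, fun v hv w hw hvw => ?_⟩
      · have h1 := this.1 v hv
        simp only [Finset.mem_filter, Finset.mem_univ, true_and] at hv
        simpa only [g', if_pos hv] using h1
      · have h1 := this.2 v hv w hw hvw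
        simp only [Finset.mem_filter, Finset.mem_univ, true_and] at hv hw
        simpa only [g', if_pos hv, if_pos hw] using h1
    · intro v hv
      simp only [Finset.mem_filter, Finset.mem_univ, true_and] at hv
      simp only [g', if_neg hv]
  have hgP : ∀ v ∈ insert u (Finset.univ.filter fun v => τ (f v) = some (s u)),
      τ (g v) = some (s u) := fun v hv => by simpa using hg.1 v hv
  have hlab : ∀ v, τ (g' v) = τ (f v) := by
    intro v
    by_cases hv : τ (f v) = some (s u)
    · simp only [g', if_pos hv]
      rw [hgP v (by simp [hv]), hv]
    · simp only [g', if_neg hv]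
  have hL : Labelled G s g' τ := ⟨hr.proper h.proper, fun v b hv => h.side v b (hlab v ▸ hv)⟩
  obtain ⟨g₂, τ₂, h1, h2, h3⟩ := hL.improvable_of_recolour (u := u) (by rw [hlab, hu])
    (hgP u (by simp)) fun a hua hga => by
      have ha : τ (f a) = some (s u) := by
        rw [← hlab, hga]; exact hgP u (by simp)
      simp only [g', if_pos ha] at hga
      exact hg.2 u (by simp) a (by simp [ha]) hua hga.symm
  refine hn ⟨g₂, τ₂, hr.trans h1, h2, ?_⟩
  have : unlabelledVertices g' τ = unlabelledVertices f τ := by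
    simp only [unlabelledVertices, hlab]
  rwa [this] at h3

open Classical in
/-- More same-sided edges than needed to join the pairs of colours that must be joined: `R` is a
set of edges whose pairs of colours are also joined by edges outside `R`. -/
theorem card_lt_mul (h : Labelled G s f τ) (hn : ¬ Improvable G s f τ)
    (hcard : (sameSide G s).edgeFinset.card < k.choose 2) {m : Fin k} (hm : τ m = none)
    {R : Finset (Sym2 V)} (hR : R ⊆ (sameSide G s).edgeFinset)
    (hR' : ∀ r ∈ R, ∃ e ∈ (sameSide G s).edgeFinset, e ∉ R ∧ e.map f = r.map f) :
    R.card < (Finset.univ.filter fun i => τ i = some true).card *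
      (Finset.univ.filter fun i => τ i = some false).card := by
  let T : Finset (Sym2 (Fin k)) := Finset.univ.filter fun z => ¬ z.IsDiag
  have hT : T.card = k.choose 2 := by
    have := Sym2.card_subtype_not_diag (α := Fin k)
    rw [Fintype.card_fin, Fintype.card_subtype] at this
    exact this
  -- `F` holds the oppositely labelled pairs, the only ones that need no edge; every other pair is
  -- still joined by an edge outside `R`.
  let F := ((Finset.univ.filter fun i => τ i = some true) ×ˢ
    (Finset.univ.filter fun i => τ i = some false)).image fun p : Fin k × Fin k => s(p.1, p.2)
  have hsub : T ⊆ F ∪ ((sameSide G s).edgeFinset \ R).image (Sym2.map f) := by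
    intro z hz
    simp only [T, Finset.mem_filter, Finset.mem_univ, true_and] at hz
    induction z using Sym2.ind with
    | _ i j =>
    have hij : i ≠ j := by simpa using hz
    have hedge : HasEdge G s f i j → s(i, j) ∈
        F ∪ ((sameSide G s).edgeFinset \ R).image (Sym2.map f) := by
      rintro ⟨u, v, huv, rfl, rfl⟩
      refine Finset.mem_union_right _ (Finset.mem_image.2 ?_)
      have hmem : s(u, v) ∈ (sameSide G s).edgeFinset := by simpa using huv
      by_cases hr : s(u, v) ∈ R
      · obtain ⟨e, he, heR, hef⟩ := hR' _ hr
        exact ⟨e, Finset.mem_sdiff.2 ⟨he, heR⟩, by simpa using hef⟩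
      · exact ⟨s(u, v), Finset.mem_sdiff.2 ⟨hmem, hr⟩, by simp⟩
    cases hi : τ i with
    | none => exact hedge (h.hasEdge_of_unlabelled hn hi hij)
    | some b =>
      cases hj : τ j with
      | none => exact hedge (h.hasEdge_of_unlabelled hn hj hij.symm).symm
      | some c =>
        by_cases hbc : b = c
        · subst hbc
          exact hedge (h.hasEdge_of_same_label hn hi hj hm hij)
        · refine Finset.mem_union_left _ (Finset.mem_image.2 ?_)
          cases b <;> cases c
          · exact absurd rfl hbc
          · exact ⟨(j, i), by simp [hi, hj], Sym2.eq_swap⟩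
          · exact ⟨(i, j), by simp [hi, hj], rfl⟩
          · exact absurd rfl hbc
  have h1 := Finset.card_le_card hsub
  have h2 := Finset.card_union_le F (((sameSide G s).edgeFinset \ R).image (Sym2.map f))
  have h3 : F.card ≤ _ := Finset.card_image_le
  rw [Finset.card_product] at h3
  have h4 : (((sameSide G s).edgeFinset \ R).image (Sym2.map f)).card ≤ _ := Finset.card_image_le
  rw [Finset.card_sdiff_of_subset hR] at h4
  have h5 := Finset.card_le_card hR
  omega

/-- Sparse graphs can be coloured from any three colours, so three labels would leave room for an
unlabelled vertex of side `b`. -/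
theorem card_label_le_two (h : Labelled G s f τ) (hn : ¬ Improvable G s f τ)
    (hH : Sparse (sameSide G s)) {m : Fin k} (hm : τ m = none) (b : Bool) :
    (Finset.univ.filter fun i => τ i = some b).card ≤ 2 := by
  classical
  by_contra hc
  obtain ⟨u, hu, rfl⟩ := h.exists_side hn hm b
  exact h.not_properOn_insert hn hH (hu ▸ hm) (hH.exists_properOn (by omega) _)

open Classical in
-- An unlabelled vertex `u` of side `b` cannot be inserted, which gives alternating walks for both
-- orders of the two labels. The first walk supplies the edges `ac` and `cz`. The edge `a'c'` of the
-- second is new: `a'` and `c` share a colour, but `a'` is adjacent to `u` and `c` is not.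
theorem exists_surplus_edges (h : Labelled G s f τ) (hn : ¬ Improvable G s f τ)
    (hH : Sparse (sameSide G s)) {m : Fin k} (hm : τ m = none) {b : Bool}
    (hb : (Finset.univ.filter fun i => τ i = some b).card = 2) :
    ∃ (R : Finset (Sym2 V)) (e : Sym2 V), R ⊆ (sameSide G s).edgeFinset ∧ R.card = 2 ∧
      e ∈ (sameSide G s).edgeFinset ∧ e ∉ R ∧ (∀ r ∈ R, e.map f = r.map f) ∧
      ∀ c ∈ e.map f, τ c = some b := by
  obtain ⟨x, x', hx, hxx⟩ := Finset.card_eq_two.1 hb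
  obtain ⟨u, hu, rfl⟩ := h.exists_side hn hm b
  have hmem : ∀ i, τ i = some (s u) ↔ i = x ∨ i = x' := by
    intro i
    have : i ∈ (Finset.univ.filter fun i => τ i = some (s u)) ↔ i = x ∨ i = x' := by
      rw [hxx]; simp
    simpa using this
  have hno := h.not_properOn_insert hn hH (u := u) (hu ▸ hm)
  rw [hxx] at hno
  simp only [hmem] at hno
  have hf : Proper (sameSide G s) f := fun v w hvw => h.proper hvw.1
  have hne : f u ≠ x ∧ f u ≠ x' := by
    rw [← not_or, ← hmem, hu, hm]; simp
  obtain ⟨a, c, z, h1, h2, h3, h4, h5, h6, h7, h8⟩ :=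
    hH.exists_alternating_walk hf hx hne hno
  obtain ⟨a', c', z', k1, k2, -, k4, -, k6, k7, -⟩ :=
    hH.exists_alternating_walk hf hx.symm hne.symm (by
      rw [Finset.pair_comm]
      simpa only [or_comm] using hno)
  refine ⟨{s(a, c), s(c, z)}, s(a', c'), ?_, ?_, ?_, ?_, ?_, ?_⟩
  · intro e he
    simp only [Finset.mem_insert, Finset.mem_singleton] at he
    rcases he with rfl | rfl <;> simpa
  · refine Finset.card_pair fun heq => ?_
    rw [Sym2.eq_iff] at heq
    grind
  · simpa
  · simp only [Finset.mem_insert, Finset.mem_singleton, Sym2.eq_iff]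
    grind
  · intro r hr
    simp only [Finset.mem_insert, Finset.mem_singleton] at hr
    rcases hr with rfl | rfl
    · rw [Sym2.map_mk, Sym2.map_mk, h6, h7, k6, k7, Sym2.eq_swap]
    · rw [Sym2.map_mk, Sym2.map_mk, h7, h8, k6, k7]
  · intro c hc
    rw [Sym2.map_mk, k6, k7, Sym2.mem_iff] at hc
    exact (hmem c).2 hc.symm

open Classical in
-- The surplus is less than the product of the two label counts, so both counts are 1 or 2. A side
-- with two labels has surplus 2, which excludes the product 2; two such sides have disjoint
-- surpluses, in total 4, which excludes the product 4.
theorem card_label_eq_one (h : Labelled G s f τ) (hn : ¬ Improvable G s f τ)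
    (hH : Sparse (sameSide G s)) (hcard : (sameSide G s).edgeFinset.card < k.choose 2)
    {m : Fin k} (hm : τ m = none) (b : Bool) :
    (Finset.univ.filter fun i => τ i = some b).card = 1 := by
  have hpos := h.card_lt_mul hn hcard hm (R := ∅) (by simp) (by simp)
  have h1 := h.card_label_le_two hn hH hm true
  have h2 := h.card_label_le_two hn hH hm false
  rw [Finset.card_empty] at hpos
  have h3 := Nat.pos_of_mul_pos_right hpos
  have h4 := Nat.pos_of_mul_pos_left hpos
  have hone : ∀ c, (Finset.univ.filter fun i => τ i = some c).card = 2 →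
      2 < (Finset.univ.filter fun i => τ i = some true).card *
      (Finset.univ.filter fun i => τ i = some false).card := by
    intro c hc
    obtain ⟨R, e, hR, hR2, he, heR, hmap, -⟩ := h.exists_surplus_edges hn hH hm hc
    rw [← hR2]
    exact h.card_lt_mul hn hcard hm hR fun r hr => ⟨e, he, heR, hmap r hr⟩
  have hboth : ¬ ((Finset.univ.filter fun i => τ i = some true).card = 2 ∧
      (Finset.univ.filter fun i => τ i = some false).card = 2) := by
    rintro ⟨ht, hf⟩
    obtain ⟨R, e, hR, hR2, he, heR, hmap, hlab⟩ := h.exists_surplus_edges hn hH hm ht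
    obtain ⟨R', e', hR', hR2', he', heR', hmap', hlab'⟩ := h.exists_surplus_edges hn hH hm hf
    have hsep : ∀ r r' : Sym2 V, r.map f = e.map f → r'.map f = e'.map f → r ≠ r' := by
      rintro r r' hr hr' rfl
      obtain ⟨c, hc⟩ : ∃ c, c ∈ r.map f := ⟨_, (r.map f).out_fst_mem⟩
      have h6 := hlab c (hr ▸ hc)
      have h7 := hlab' c (hr' ▸ hc)
      rw [h6] at h7
      simp at h7
    have hdisj : Disjoint R R' := Finset.disjoint_left.2 fun r hr hr' =>
      hsep r r (hmap r hr).symm (hmap' r hr').symm rfl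
    have := h.card_lt_mul hn hcard hm (Finset.union_subset hR hR') (by
      intro r hr
      rcases Finset.mem_union.1 hr with hr | hr
      · refine ⟨e, he, fun hc => ?_, hmap r hr⟩
        rcases Finset.mem_union.1 hc with hc | hc
        · exact heR hc
        · exact hsep e e rfl (hmap' e hc).symm rfl
      · refine ⟨e', he', fun hc => ?_, hmap' r hr⟩
        rcases Finset.mem_union.1 hc with hc | hc
        · exact hsep e' e' (hmap e' hc).symm rfl rfl
        · exact heR' hc)
    rw [Finset.card_union_of_disjoint hdisj, hR2, hR2', ht, hf] at this
    omega
  have h5 := hone true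
  have h6 := hone false
  have hall : (Finset.univ.filter fun i => τ i = some true).card = 1 ∧
      (Finset.univ.filter fun i => τ i = some false).card = 1 := by
    generalize (Finset.univ.filter fun i => τ i = some true).card = p at *
    generalize (Finset.univ.filter fun i => τ i = some false).card = q at *
    interval_cases p <;> interval_cases q <;> simp_all
  cases b
  · exact hall.2
  · exact hall.1

end Labelled

end Labels

/-! ### Colourings that cannot be improved are pure -/

section Purification

variable {V : Type*} [Fintype V] {G : SimpleGraph V} {s : V → Bool} {k : ℕ}

namespace Labelled

variable {f : V → Fin k} {τ : Fin k → Option Bool}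

open Classical in
theorem exists_unique_label (h : Labelled G s f τ) (hn : ¬ Improvable G s f τ)
    (hH : Sparse (sameSide G s)) (hcard : (sameSide G s).edgeFinset.card < k.choose 2)
    {m : Fin k} (hm : τ m = none) (b : Bool) :
    ∃ x, τ x = some b ∧ ∀ y, τ y = some b → y = x := by
  obtain ⟨x, hx⟩ := Finset.card_eq_one.1 (h.card_label_eq_one hn hH hcard hm b)
  have : ∀ i, i ∈ (Finset.univ.filter fun i => τ i = some b) ↔ i = x := by
    intro i; rw [hx, Finset.mem_singleton]
  simp only [Finset.mem_filter, Finset.mem_univ, true_and] at this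
  exact ⟨x, (this x).2 rfl, fun y hy => (this y).1 hy⟩

open Classical in
-- A second edge between the same colours would be surplus, but the surplus is now less than `1 *
-- 1`.
theorem edge_unique (h : Labelled G s f τ) (hn : ¬ Improvable G s f τ)
    (hH : Sparse (sameSide G s)) (hcard : (sameSide G s).edgeFinset.card < k.choose 2)
    {m : Fin k} (hm : τ m = none) {u v u' v' : V} (huv : (sameSide G s).Adj u v)
    (huv' : (sameSide G s).Adj u' v') (hu : f u = f u') (hv : f v = f v') : u = u' ∧ v = v' := by
  by_cases heq : s(u, v) = s(u', v')
  · rw [Sym2.eq_iff] at heq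
    rcases heq with heq | ⟨rfl, rfl⟩
    · exact heq
    · exact absurd hu (h.proper huv.1)
  · have := h.card_lt_mul hn hcard hm (R := {s(u, v)}) (by simpa) (by
      intro r hr
      rw [Finset.mem_singleton] at hr
      subst hr
      exact ⟨s(u', v'), by simpa, by simpa using Ne.symm heq, by simp [hu, hv]⟩)
    rw [h.card_label_eq_one hn hH hcard hm, h.card_label_eq_one hn hH hcard hm] at this
    simp at this

open Classical in
theorem card_unlabelled (h : Labelled G s f τ) (hn : ¬ Improvable G s f τ)
    (hH : Sparse (sameSide G s)) (hcard : (sameSide G s).edgeFinset.card < k.choose 2)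
    {m : Fin k} (hm : τ m = none) : (unlabelled τ).card + 2 = k := by
  have h1 := h.card_label_eq_one hn hH hcard hm true
  have h2 := h.card_label_eq_one hn hH hcard hm false
  have h3 := Finset.card_eq_sum_card_fiberwise (s := (Finset.univ : Finset (Fin k))) (f := τ)
    (t := Finset.univ) (by simp)
  rw [Finset.card_univ, Fintype.card_fin, Fintype.sum_option, Fintype.sum_bool] at h3
  unfold unlabelled
  omega

open Classical in
/-- In a labelled colouring that cannot be improved, edges between an unlabelled colour and two
other unlabelled colours lie on different sides. -/
theorem side_ne (h : Labelled G s f τ) (hn : ¬ Improvable G s f τ)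
    (hH : Sparse (sameSide G s)) (hcard : (sameSide G s).edgeFinset.card < k.choose 2)
    {i j l : Fin k} (hi : τ i = none) (hj : τ j = none) (hl : τ l = none) (hjl : j ≠ l)
    {u v u' v' : V} (huv : (sameSide G s).Adj u v) (huv' : (sameSide G s).Adj u' v')
    (hu : f u = i) (hv : f v = j) (hu' : f u' = i) (hv' : f v' = l) : s u ≠ s u' := by
  intro hs
  -- Both `u` and `u'` have a neighbour coloured `x`, so uniqueness of edges gives `u = u'`. Then
  -- `v`, `a`, `v'` are neighbours of `u`, and `a`, being a twin of `v`, is adjacent to an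
  -- `x`-coloured neighbour `c` of `v`; yet `a` is itself coloured `x`.
  obtain ⟨x, hx, -⟩ := h.exists_unique_label hn hH hcard hi (s u)
  obtain ⟨a, hua, ha⟩ := h.exists_neighbour hn (hu ▸ hi) hx
  obtain ⟨a', hua', ha'⟩ := h.exists_neighbour hn (u := u') (hu' ▸ hi) (hs ▸ hx)
  obtain ⟨rfl, rfl⟩ := h.edge_unique hn hH hcard hi hua hua' (hu.trans hu'.symm)
    (ha.trans ha'.symm)
  obtain ⟨c, hvc, hc⟩ := h.exists_neighbour hn (u := v) (hv ▸ hj) (huv.2 ▸ hx)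
  have hva : v ≠ a := by
    rintro rfl
    rw [← hv, ha, hx] at hj
    simp at hj
  have hva' : v' ≠ a := by
    rintro rfl
    rw [← hv', ha, hx] at hl
    simp at hl
  have hvv' : v ≠ v' := fun h => hjl (hv.symm.trans ((congrArg f h).trans hv'))
  exact h.proper (hH.twins huv hua huv' hva hvv' hva'.symm c hvc).1 (ha.trans hc.symm)

theorem improvable_of_nearlyPurifiable (h : NearlyPurifiable G s f) (hf : Proper G f)
    (hτ : 1 < (unlabelled τ).card) : Improvable G s f τ := by
  classical
  obtain ⟨g, hr, m, hm⟩ := h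
  choose! b hb using hm
  refine ⟨g, fun i => if i = m then none else some (b i), hr, ⟨hr.proper hf, fun v c hv => ?_⟩,
    Or.inl (lt_of_le_of_lt ?_ hτ)⟩
  · split_ifs at hv with hvm
    rw [← Option.some.inj hv]
    exact hb _ hvm v rfl
  · rw [← Finset.card_singleton m]
    refine Finset.card_le_card fun i hi => ?_
    simp only [unlabelled, Finset.mem_filter, Finset.mem_univ, true_and] at hi
    rw [Finset.mem_singleton]
    by_contra hc
    simp [hc] at hi

open Classical in
-- Each vertex of an unlabelled colour has a neighbour in the labelled colour of its side, and such
-- edges are unique. So `i` and `j` have exactly one vertex on either side, and the colouring is a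
-- `TightConfig`, with `b` the side of the edge between `i` and `j`.
theorem improvable_of_four_colours (h : Labelled G s f τ) (hH : Sparse (sameSide G s))
    (hcard : (sameSide G s).edgeFinset.card < k.choose 2) (hk : k = 4) (hcol : G.Colorable 3)
    {m : Fin k} (hm : τ m = none) : Improvable G s f τ := by
  by_contra hn
  have hM := h.card_unlabelled hn hH hcard hm
  obtain ⟨i, j, hij, hM'⟩ := Finset.card_eq_two.1 (show (unlabelled τ).card = 2 by omega)
  have hnone : ∀ l, τ l = none ↔ l = i ∨ l = j := by
    intro l
    have : l ∈ unlabelled τ ↔ l = i ∨ l = j := by rw [hM']; simp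
    simpa [unlabelled] using this
  have hi : τ i = none := (hnone i).2 (Or.inl rfl)
  have hj : τ j = none := (hnone j).2 (Or.inr rfl)
  obtain ⟨u₁, u₂, huu, hu₁, hu₂⟩ := h.hasEdge_of_unlabelled hn hi hij
  obtain ⟨x, hx, hx'⟩ := h.exists_unique_label hn hH hcard hm (s u₁)
  obtain ⟨y, hy, hy'⟩ := h.exists_unique_label hn hH hcard hm (!s u₁)
  obtain ⟨w₁, hw₁, hsw₁⟩ := h.exists_side hn hi (!s u₁)
  obtain ⟨w₂, hw₂, hsw₂⟩ := h.exists_side hn hj (!s u₁)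
  obtain ⟨a₁, ha₁, fa₁⟩ := h.exists_neighbour hn (hu₁ ▸ hi) hx
  obtain ⟨a₂, ha₂, fa₂⟩ := h.exists_neighbour hn (u := u₂) (hu₂ ▸ hj) (huu.2 ▸ hx)
  obtain ⟨b₁, hb₁, fb₁⟩ := h.exists_neighbour hn (u := w₁) (hw₁ ▸ hi) (hsw₁ ▸ hy)
  obtain ⟨b₂, hb₂, fb₂⟩ := h.exists_neighbour hn (u := w₂) (hw₂ ▸ hj) (hsw₂ ▸ hy)
  have uniq := fun {u v u' v'} => h.edge_unique hn hH hcard hm (u := u) (v := v) (u' := u')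
    (v' := v')
  have sx : ∀ v, f v = x → s v = s u₁ := fun v hv => h.side v _ (hv ▸ hx)
  have sy : ∀ v, f v = y → s v = !s u₁ := fun v hv => h.side v _ (hv ▸ hy)
  have class_eq : ∀ l, τ l = none → ∀ u w a b, (sameSide G s).Adj u a → (sameSide G s).Adj w b →
      f u = l → f w = l → f a = x → f b = y → s u = s u₁ → (s w = !s u₁) →
      ∀ v, f v = l ↔ v = u ∨ v = w := by
    intro l hl u w a b hua hwb hu hw ha hb hsu hsw v
    refine ⟨fun hv => ?_, by rintro (rfl | rfl) <;> assumption⟩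
    rcases bool_eq_or_eq_not (s v) (s u₁) with hs | hs
    · obtain ⟨c, hvc, hc⟩ := h.exists_neighbour hn (u := v) (hv ▸ hl) (hs ▸ hx)
      exact Or.inl (uniq hvc hua (hv.trans hu.symm) (hc.trans ha.symm)).1
    · obtain ⟨c, hvc, hc⟩ := h.exists_neighbour hn (u := v) (hv ▸ hl) (hs ▸ hy)
      exact Or.inr (uniq hvc hwb (hv.trans hw.symm) (hc.trans hb.symm)).1
  have hne : ∀ l b, τ l = some b → i ≠ l ∧ j ≠ l := by
    intro l b hl
    constructor
    · rintro rfl; rw [hi] at hl; simp at hl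
    · rintro rfl; rw [hj] at hl; simp at hl
  obtain ⟨ψ⟩ := hcol
  refine hn (improvable_of_nearlyPurifiable (TightConfig.nearlyPurifiable
    (i := i) (j := j) (x := x) (y := y) (b := s u₁) (u₁ := u₁) (u₂ := u₂) (w₁ := w₁) (w₂ := w₂)
    (a₁ := a₁) (a₂ := a₂) (b₁ := b₁) (b₂ := b₂) ?_
    (ψ := ψ) fun u v huv => ψ.valid huv) h.proper (by omega))
  exact
    { proper := h.proper
      colours := fun l => by
        cases hl : τ l with
        | none => rcases (hnone l).1 hl with h | h <;> simp [h]
        | some b =>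
          rcases bool_eq_or_eq_not b (s u₁) with rfl | rfl
          · simp [hx' l hl]
          · simp [hy' l hl]
      ij := hij
      ix := (hne x _ hx).1
      iy := (hne y _ hy).1
      jx := (hne x _ hx).2
      jy := (hne y _ hy).2
      xy := by
        rintro rfl
        rw [hx] at hy
        simp at hy
      side_x := sx
      side_y := sy
      f_i := class_eq i hi u₁ w₁ a₁ b₁ ha₁ hb₁ hu₁ hw₁ fa₁ fb₁ rfl hsw₁
      f_j := class_eq j hj u₂ w₂ a₂ b₂ ha₂ hb₂ hu₂ hw₂ fa₂ fb₂ huu.2.symm hsw₂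
      su₁ := rfl
      su₂ := huu.2.symm
      sw₁ := hsw₁
      sw₂ := hsw₂
      uu := huu.1
      ww := fun hw => by
        have := (uniq ⟨hw, hsw₁.trans hsw₂.symm⟩ huu (hw₁.trans hu₁.symm) (hw₂.trans hu₂.symm)).1
        rw [this] at hsw₁
        simp at hsw₁
      fa₁ := fa₁
      fa₂ := fa₂
      fb₁ := fb₁
      fb₂ := fb₂
      ua₁ := ha₁.1
      ua₂ := ha₂.1
      wb₁ := hb₁.1
      wb₂ := hb₂.1
      eq_a₁ := fun v hv hx => (uniq ⟨hv, (sx v hx).symm⟩ ha₁ rfl (hx.trans fa₁.symm)).2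
      eq_a₂ := fun v hv hx =>
        (uniq ⟨hv, huu.2.symm.trans (sx v hx).symm⟩ ha₂ rfl (hx.trans fa₂.symm)).2
      eq_b₁ := fun v hv hy =>
        (uniq ⟨hv, hsw₁.trans (sy v hy).symm⟩ hb₁ rfl (hy.trans fb₁.symm)).2
      eq_b₂ := fun v hv hy =>
        (uniq ⟨hv, hsw₂.trans (sy v hy).symm⟩ hb₂ rfl (hy.trans fb₂.symm)).2
      aa := by
        rintro rfl
        exact hH.triangleFree huu ha₂ ha₁ }

open Classical in
-- For `k ≥ 5` there are three unlabelled colours. By `side_ne` the three edges joining them lie on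
-- pairwise different sides, but there are only two sides.
theorem improvable (h : Labelled G s f τ) (hH : Sparse (sameSide G s))
    (hcard : (sameSide G s).edgeFinset.card < k.choose 2) (hk : 4 ≤ k)
    (hcol : G.Colorable (k - 1)) {m : Fin k} (hm : τ m = none) : Improvable G s f τ := by
  obtain hk | hk := hk.eq_or_lt
  · exact h.improvable_of_four_colours hH hcard hk.symm (by subst hk; exact hcol) hm
  by_contra hn
  have hM := h.card_unlabelled hn hH hcard hm
  obtain ⟨i, j, l, hi, hj, hl, hij, hil, hjl⟩ :=
    Finset.two_lt_card_iff.1 (show 2 < (unlabelled τ).card by omega)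
  simp only [unlabelled, Finset.mem_filter, Finset.mem_univ, true_and] at hi hj hl
  obtain ⟨u₁, v₁, e₁, hu₁, hv₁⟩ := h.hasEdge_of_unlabelled hn hi hij
  obtain ⟨u₂, v₂, e₂, hu₂, hv₂⟩ := h.hasEdge_of_unlabelled hn hi hil
  obtain ⟨u₃, v₃, e₃, hu₃, hv₃⟩ := h.hasEdge_of_unlabelled hn hj hjl
  have n₁ := h.side_ne hn hH hcard hi hj hl hjl e₁ e₂ hu₁ hv₁ hu₂ hv₂
  have n₂ := h.side_ne hn hH hcard hj hi hl hil e₁.symm e₃ hv₁ hu₁ hu₃ hv₃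
  have n₃ := h.side_ne hn hH hcard hl hi hj hij e₂.symm e₃.symm hv₂ hu₂ hv₃ hu₃
  rw [← e₁.2] at n₂
  rw [← e₂.2, ← e₃.2] at n₃
  revert n₁ n₂ n₃
  cases s u₁ <;> cases s u₂ <;> cases s u₃ <;> simp

open Classical in
/-- Every colouring is equivalent to one with one-sided colour classes. -/
theorem exists_pure (h : Labelled G s f τ) (hH : Sparse (sameSide G s))
    (hcard : (sameSide G s).edgeFinset.card < k.choose 2) (hk : 4 ≤ k)
    (hcol : G.Colorable (k - 1)) :
    ∃ (g : V → Fin k) (σ : Fin k → Bool), Reach G f g ∧ ∀ v, σ (g v) = s v := by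
  induction hp : (unlabelled τ).card using Nat.strong_induction_on generalizing f τ with
  | _ p ihp =>
  induction hq : (unlabelledVertices f τ).card using Nat.strong_induction_on generalizing f τ with
  | _ q ihq =>
  by_cases hall : ∀ i, τ i ≠ none
  · have : ∀ i, ∃ b, τ i = some b := fun i => Option.ne_none_iff_exists'.1 (hall i)
    choose σ hσ using this
    exact ⟨f, σ, Reach.refl f, fun v => (h.side v _ (hσ _)).symm⟩
  · push Not at hall
    obtain ⟨m, hm⟩ := hall
    obtain ⟨g, τ', hr, hg, hlt | ⟨heq, hlt⟩⟩ := h.improvable hH hcard hk hcol hm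
    · obtain ⟨g', σ, h1, h2⟩ := ihp _ (hp ▸ hlt) hg rfl
      exact ⟨g', σ, hr.trans h1, h2⟩
    · obtain ⟨g', σ, h1, h2⟩ := ihq _ (hq ▸ hlt) hg (heq.trans hp) rfl
      exact ⟨g', σ, hr.trans h1, h2⟩

end Labelled

open Classical in
theorem reach_of_sparse_sameSide (hH : Sparse (sameSide G s))
    (hcard : (sameSide G s).edgeFinset.card < k.choose 2) (hk : 4 ≤ k)
    (hcol : G.Colorable (k - 1)) {f g : V → Fin k} (hf : Proper G f) (hg : Proper G g) :
    Reach G f g := by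
  obtain ⟨f', σ, h1, h2⟩ := Labelled.exists_pure (s := s) (τ := fun _ => none) ⟨hf, by simp⟩
    hH hcard hk hcol
  obtain ⟨g', σ', h3, h4⟩ := Labelled.exists_pure (s := s) (τ := fun _ => none) ⟨hg, by simp⟩
    hH hcard hk hcol
  exact h1.trans ((reach_of_pure hH (h1.proper hf) (h3.proper hg) h2 h4).trans h3.symm)

end Purification

/-! ### Paths, long cycles and complete bipartite graphs are sparse -/

section Components

variable {V W : Type*}

theorem Sparse.of_iso {H : SimpleGraph V} {H' : SimpleGraph W} (e : H ≃g H') (h : Sparse H') :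
    Sparse H where
  triangleFree _ _ _ hab hbc hac :=
    h.triangleFree (e.map_rel_iff.2 hab) (e.map_rel_iff.2 hbc) (e.map_rel_iff.2 hac)
  twins _ _ _ _ ha hb hd hab had hbd w hw :=
    e.map_rel_iff.1 (h.twins (e.map_rel_iff.2 ha) (e.map_rel_iff.2 hb) (e.map_rel_iff.2 hd)
      (e.injective.ne hab) (e.injective.ne had) (e.injective.ne hbd) (e w) (e.map_rel_iff.2 hw))

theorem sparse_pathGraph (n : ℕ) : Sparse (SimpleGraph.pathGraph n) where
  triangleFree a b c hab hbc hac := by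
    simp only [SimpleGraph.pathGraph_adj] at hab hbc hac
    omega
  twins u a b d ha hb hd hab had hbd := by
    simp only [SimpleGraph.pathGraph_adj] at ha hb hd
    omega

theorem val_of_cycleGraph_adj {n : ℕ} {a b : Fin n} (h : (SimpleGraph.cycleGraph n).Adj a b) :
    a.val = b.val + 1 ∨ b.val = a.val + 1 ∨ (a.val = 0 ∧ b.val + 1 = n) ∨
      (b.val = 0 ∧ a.val + 1 = n) := by
  have key : ∀ c d : Fin n, (c - d).val = 1 → c.val = d.val + 1 ∨ (c.val = 0 ∧ d.val + 1 = n) := by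
    intro c d hcd
    rcases le_or_gt d c with hle | hlt
    · rw [Fin.coe_sub_iff_le.2 hle] at hcd
      omega
    · rw [Fin.coe_sub_iff_lt.2 hlt] at hcd
      omega
  rw [SimpleGraph.cycleGraph_adj'] at h
  rcases h with h | h
  · have := key a b h
    omega
  · have := key b a h
    omega

/-- Length at least 4 rules out triangles; the twin condition is vacuous, as no vertex has three
neighbours. -/
theorem sparse_cycleGraph {n : ℕ} (hn : 4 ≤ n) : Sparse (SimpleGraph.cycleGraph n) where
  triangleFree a b c hab hbc hac := by
    have h1 := val_of_cycleGraph_adj hab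
    have h2 := val_of_cycleGraph_adj hbc
    have h3 := val_of_cycleGraph_adj hac
    omega
  twins u a b d ha hb hd hab had hbd := by
    exfalso
    have h1 := val_of_cycleGraph_adj ha
    have h2 := val_of_cycleGraph_adj hb
    have h3 := val_of_cycleGraph_adj hd
    omega

theorem sparse_completeBipartiteGraph : Sparse (completeBipartiteGraph V W) where
  triangleFree a b c hab hbc hac := by
    cases a <;> cases b <;> cases c <;> simp_all
  twins u a b d ha hb hd hab had hbd w hw := by
    cases u <;> cases a <;> cases b <;> cases w <;> simp_all

theorem Sparse.of_components {H : SimpleGraph V}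
    (h : ∀ C : H.ConnectedComponent, Sparse C.toSimpleGraph) : Sparse H where
  triangleFree a b c hab hbc hac := by
    let C := H.connectedComponentMk a
    have hb : b ∈ C.supp := SimpleGraph.ConnectedComponent.sound hab.symm.reachable
    have hc : c ∈ C.supp := SimpleGraph.ConnectedComponent.sound hac.symm.reachable
    exact (h C).triangleFree (a := ⟨a, rfl⟩) (b := ⟨b, hb⟩) (c := ⟨c, hc⟩) hab hbc hac
  twins u a b d ha hb hd hab had hbd w hw := by
    let C := H.connectedComponentMk u
    have ha' : a ∈ C.supp := SimpleGraph.ConnectedComponent.sound ha.symm.reachable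
    have hb' : b ∈ C.supp := SimpleGraph.ConnectedComponent.sound hb.symm.reachable
    have hd' : d ∈ C.supp := SimpleGraph.ConnectedComponent.sound hd.symm.reachable
    have hw' : w ∈ C.supp :=
      SimpleGraph.ConnectedComponent.sound (hw.symm.reachable.trans ha.symm.reachable)
    exact (h C).twins (u := ⟨u, rfl⟩) (a := ⟨a, ha'⟩) (b := ⟨b, hb'⟩) (d := ⟨d, hd'⟩) ha hb hd
      (by simpa using hab) (by simpa using had) (by simpa using hbd) ⟨w, hw'⟩ hw

theorem Sparse.sameSide {G E : SimpleGraph V} (hE : Sparse E) {s : V → Bool}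
    (h : ∀ u v, (sameSide G s).Adj u v ↔ E.Adj u v ∧ s u = s v) : Sparse (sameSide G s) where
  triangleFree a b c hab hbc hac :=
    hE.triangleFree ((h _ _).1 hab).1 ((h _ _).1 hbc).1 ((h _ _).1 hac).1
  twins u a b d ha hb hd hab had hbd w hw := by
    rw [h] at ha hb hd hw ⊢
    exact ⟨hE.twins ha.1 hb.1 hd.1 hab had hbd w hw.1, by rw [← hb.2, ha.2, hw.2]⟩

end Components

end Kempe

/-! ### The theorem -/

theorem theorem5 {V : Type*} [Finite V] (k ℓ : ℕ) (hk : 4 ≤ k) (hℓ : ℓ < k.choose 2)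
    (G B E : SimpleGraph V) (hcol : G.Colorable (k - 1))
    (hG : Kempe.IsBipartiteAdd G B E ℓ)
    (hcomp : ∀ C : E.ConnectedComponent,
      Kempe.IsPathGraph C.toSimpleGraph ∨ Kempe.IsLongCycleGraph C.toSimpleGraph ∨
        Kempe.IsCompleteBipartiteGraph C.toSimpleGraph) :
    Kempe.Kc G k = 1 := by
  classical
  have := Fintype.ofFinite V
  obtain ⟨hbip, -, rfl, hcard⟩ := hG
  obtain ⟨β⟩ := hbip
  let s : V → Bool := fun v => decide (β v = 0)
  have hE : Kempe.Sparse E := Kempe.Sparse.of_components fun C => by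
    rcases hcomp C with ⟨n, ⟨e⟩⟩ | ⟨n, hn, ⟨e⟩⟩ | ⟨m, n, -, -, ⟨e⟩⟩
    · exact (Kempe.sparse_pathGraph n).of_iso e
    · exact (Kempe.sparse_cycleGraph hn).of_iso e
    · exact Kempe.sparse_completeBipartiteGraph.of_iso e
  have hs : ∀ u v, (Kempe.sameSide (B ⊔ E) s).Adj u v ↔ E.Adj u v ∧ s u = s v := by
    intro u v
    -- `β` takes only two values, so an edge of `B` always changes sides.
    refine ⟨fun ⟨h1, h2⟩ => ⟨h1.resolve_left fun hB => β.valid hB ?_, h2⟩,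
      fun ⟨h1, h2⟩ => ⟨Or.inr h1, h2⟩⟩
    simp only [s, decide_eq_decide] at h2
    omega
  have hlt : (Kempe.sameSide (B ⊔ E) s).edgeFinset.card < k.choose 2 := by
    refine lt_of_le_of_lt ?_ hℓ
    rw [← hcard, ← SimpleGraph.coe_edgeFinset, Set.ncard_coe_finset]
    exact Finset.card_le_card (SimpleGraph.edgeFinset_mono fun u v h => ((hs u v).1 h).1)
  rw [Kempe.Kc, Nat.card_eq_one_iff_unique]
  refine ⟨⟨fun a b => ?_⟩, ?_⟩
  · induction a using Quotient.inductionOn with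
    | _ c =>
    induction b using Quotient.inductionOn with
    | _ d =>
    exact Quotient.sound (Kempe.Reach.kempeEquiv c d (Kempe.reach_of_sparse_sameSide
      (hE.sameSide hs) hlt hk hcol (fun u v h => c.valid h) fun u v h => d.valid h))
  -- There is at least one class, because a colouring with `k - 1` colours yields one with `k`.
  · obtain ⟨c⟩ := hcol.mono (Nat.sub_le k 1)
    exact ⟨Quotient.mk _ c⟩
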